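/- Consider the class of generalized Burgers equations $$u_t+uu_x=g(t)\,u_{xx},\qquad g\neq 0,\qquad (*)$$ whose arbitrary element $g$ is a smooth nowhere vanishing function on an open interval of $\mathbb R$. A \emph{point transformation} is a smooth map $\Phi=(T,X,U)$, $\tilde t=T(t,x,u)$, $\tilde x=X(t,x,u)$, $\tilde u=U(t,x,u)$, with nonvanishing Jacobian on a nonempty connected open set $\Omega\subset\mathbb R^3$. It \emph{maps} the equation with coefficient $g$ to the equation with coefficient $\tilde g$ if its second prolongation, wherever it is defined over $\Omega$, maps the manifold defined by the first equation in the second-order jet space to the one defined by the second equation, in the sense that a jet satisfies the first equation if and only if its image satisfies the second; the triple $(g,\tilde g,\Phi)$ is then an \emph{admissible transformation} of the class. The \emph{usual equivalence group} of the class is the (pseudo)group of point transformations $(t,x,u,g)\mapsto(\tilde t,\tilde x,\tilde u,\tilde g)$, defined for $(t,x,u)$ in a nonempty connected open set $\Omega$ and all $g\ne0$, whose components for $(t,x,u)$ do not depend on $g$ and which map every equation of the class (over the part of $\Omega$ where the equation is defined) to an equation of the class, the graph of the coefficient of the former being mapped to that of the latter. The class is \emph{normalized in the usual sense} if each of its admissible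 transformations $(g,\tilde g,\Phi)$ is induced by an element of the usual equivalence group, i.e. $\Phi$ is the $(t,x,u)$-component of that element and $\tilde g$ is the image of $g$ under it. Then the class $(*)$ is normalized in the usual sense, and its usual equivalence group consists of the transformations $$\tilde t=\frac{\alpha t+\beta}{\gamma t+\delta},\qquad \tilde x=\frac{x+\mu_1t+\mu_0}{\gamma t+\delta},\qquad \tilde u=\frac{(\gamma t+\delta)u-\gamma x+\mu_1\delta-\mu_0\gamma}{\alpha\delta-\beta\gamma},\qquad \tilde g=\frac{g}{\alpha\delta-\beta\gamma},$$ where $\alpha,\beta,\gamma,\delta,\mu_0,\mu_1$ are arbitrary real constants with $\alpha\delta-\beta\gamma\neq0$, each considered on an arbitrary nonempty connected open set $\Omega$ of points $(t,x,u)$ on which $\gamma t+\delta\ne0$. -/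

import Mathlib

open scoped ContDiff Topology

/-- A member of the class `u_t + u u_x = g(t) u_xx`: an open interval `dom` of times together with
a coefficient `g = coeff` that is smooth and nowhere zero on it.
(The values of `coeff` outside `dom` play no role.) -/
structure BurgersEq where
  dom : Set ℝ
  coeff : ℝ → ℝ
  isOpen_dom : IsOpen dom
  isConnected_dom : IsConnected dom
  contDiffOn_coeff : ContDiffOn ℝ ∞ coeff dom
  coeff_ne_zero : ∀ t ∈ dom, coeff t ≠ 0

/-- The function `v` of `(t, x)` satisfies `v_t + v v_x = g v_xx` at the point `q = (t, x)`. -/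
def SatisfiesBurgersAt (g : ℝ → ℝ) (v : ℝ × ℝ → ℝ) (q : ℝ × ℝ) : Prop :=
  deriv (fun t => v (t, q.2)) q.1 + v q * deriv (fun x => v (q.1, x)) q.2 =
    g q.1 * deriv (deriv (fun x => v (q.1, x))) q.2

/-- The point `(t, x, v(t, x))` of the graph of `v`. -/
def graphPt (v : ℝ × ℝ → ℝ) (q : ℝ × ℝ) : ℝ × ℝ × ℝ := (q.1, q.2, v q)

/-- The new independent variables `(T, X)`, evaluated along the graph of `v`, where
`Φ = (T, X, U)`. -/
def newIndep (Φ : ℝ × ℝ × ℝ → ℝ × ℝ × ℝ) (v : ℝ × ℝ → ℝ) (q : ℝ × ℝ) : ℝ × ℝ :=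
  ((Φ (graphPt v q)).1, (Φ (graphPt v q)).2.1)

/-- The new dependent variable `U`, evaluated along the graph of `v`, where `Φ = (T, X, U)`. -/
def newDep (Φ : ℝ × ℝ × ℝ → ℝ × ℝ × ℝ) (v : ℝ × ℝ → ℝ) (q : ℝ × ℝ) : ℝ :=
  (Φ (graphPt v q)).2.2

/-- Over the set `Ω` of points `(t, x, u)`, the transformation `Φ` maps the equation with
coefficient `g` to the equation with coefficient `g'`: a second-order jet over `Ω` lies on the
manifold that the first equation defines in the jet space if and only if its image under the second
prolongation of `Φ` lies on the manifold that the second equation defines.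

A jet is given by a representative `v` at `q`. Its image under the prolongation is defined when
`(t, x) ↦ (T, X)(t, x, v(t, x))` has nonzero Jacobian at `q`, and is then the jet of the function
`w` whose graph is, locally, the image of the graph of `v`. Here `v` need not be a solution. -/
def MapsBurgers (Ω : Set (ℝ × ℝ × ℝ)) (Φ : ℝ × ℝ × ℝ → ℝ × ℝ × ℝ) (g g' : ℝ → ℝ) : Prop :=
  ∀ (v w : ℝ × ℝ → ℝ) (q : ℝ × ℝ),
    graphPt v q ∈ Ω →
    ContDiffAt ℝ ∞ v q →
    (fderiv ℝ (newIndep Φ v) q).det ≠ 0 →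
    ContDiffAt ℝ ∞ w (newIndep Φ v q) →
    (∀ᶠ r in 𝓝 q, w (newIndep Φ v r) = newDep Φ v r) →
    (SatisfiesBurgersAt g v q ↔ SatisfiesBurgersAt g' w (newIndep Φ v q))

/-- `Φ = (T, X, U)` is a point transformation of the space of `(t, x, u)` with domain of
definition `Ω`: a smooth map with nonvanishing Jacobian on the (open, connected) domain `Ω`. -/
structure IsPointTransformation (Ω : Set (ℝ × ℝ × ℝ)) (Φ : ℝ × ℝ × ℝ → ℝ × ℝ × ℝ) : Prop where
  isOpen : IsOpen Ω
  isConnected : IsConnected Ω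
  contDiffOn : ContDiffOn ℝ ∞ Φ Ω
  det_ne_zero : ∀ p ∈ Ω, (fderiv ℝ Φ p).det ≠ 0

/-- `(L, L', Φ)` is an admissible transformation of the class, with domain of definition `Ω`:
the point transformation `Φ` maps the equation `L` to the equation `L'`. -/
structure IsAdmissible (L L' : BurgersEq) (Ω : Set (ℝ × ℝ × ℝ))
    (Φ : ℝ × ℝ × ℝ → ℝ × ℝ × ℝ) : Prop where
  isPointTransformation : IsPointTransformation Ω Φ
  source : ∀ p ∈ Ω, p.1 ∈ L.dom
  target : ∀ p ∈ Ω, (Φ p).1 ∈ L'.dom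
  maps : MapsBurgers Ω Φ L.coeff L'.coeff

/-- `Ψ` belongs to the usual equivalence (pseudo)group of the class, with `Ω` the domain in
the space of `(t, x, u)` over which it is defined: `Ψ` is a point transformation of the space of
`(t, x, u, g)`, `g ≠ 0`, written as `((t, x, u), g)`, whose components for `(t, x, u)` do not
depend on the arbitrary element `g`, and which maps every equation of the class to an equation of
the class. -/
structure IsUsualEquivalence (Ω : Set (ℝ × ℝ × ℝ))
    (Ψ : (ℝ × ℝ × ℝ) × ℝ → (ℝ × ℝ × ℝ) × ℝ) : Prop where
  isOpen : IsOpen Ω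
  isConnected : IsConnected Ω
  contDiffOn : ContDiffOn ℝ ∞ Ψ (Ω ×ˢ {a : ℝ | a ≠ 0})
  det_ne_zero : ∀ p ∈ Ω, ∀ a : ℝ, a ≠ 0 → (fderiv ℝ Ψ (p, a)).det ≠ 0
  projectable : ∀ p ∈ Ω, ∀ a b : ℝ, a ≠ 0 → b ≠ 0 → (Ψ (p, a)).1 = (Ψ (p, b)).1
  /-- Each equation `L` of the class is mapped, over the part of `Ω` where it is defined, to an
  equation `L'` of the class, whose coefficient is the image of the coefficient of `L`. -/
  maps : ∀ L : BurgersEq, ∃ L' : BurgersEq,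
    (∀ p ∈ Ω, p.1 ∈ L.dom →
      (Ψ (p, L.coeff p.1)).1.1 ∈ L'.dom ∧
      L'.coeff (Ψ (p, L.coeff p.1)).1.1 = (Ψ (p, L.coeff p.1)).2) ∧
    MapsBurgers {p ∈ Ω | p.1 ∈ L.dom} (fun p => (Ψ (p, L.coeff p.1)).1) L.coeff L'.coeff

/-- The class is normalized in the usual sense: its equivalence groupoid is generated by its usual
equivalence group, that is, each admissible transformation `(L, L', Φ)` is induced by a
transformation from the usual equivalence group, whose `(t, x, u)`-components give `Φ` and which
maps the coefficient of `L` to the coefficient of `L'`. (That, conversely, usual equivalence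
transformations induce admissible transformations is part of their definition.) -/
def BurgersNormalizedUsual : Prop :=
  ∀ (L L' : BurgersEq) (Ω : Set (ℝ × ℝ × ℝ)) (Φ : ℝ × ℝ × ℝ → ℝ × ℝ × ℝ),
    IsAdmissible L L' Ω Φ →
    ∃ Ψ : (ℝ × ℝ × ℝ) × ℝ → (ℝ × ℝ × ℝ) × ℝ, IsUsualEquivalence Ω Ψ ∧
      ∀ p ∈ Ω, Ψ (p, L.coeff p.1) = (Φ p, L'.coeff (Φ p).1)

/-! The argument is the direct method for point transformations, made pointwise on jets. Any
first-order data `p`, `r` and pure second derivatives `a`, `c` over a point of `Ω` are realized by a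
quadratic polynomial, so `MapsBurgers` becomes an algebraic condition on the derivatives of `Φ = (T,
X, U)` (`MapsBurgers.jet`). Mixed second derivatives are not needed.

Since `v_tt` is absent from the source equation, varying it alone must not affect the image
equation; this forces `T_x = T_u = 0` (`MapsBurgers.time_stationary`). Varying `v_t` with `v_xx`
adjusted so that the equation holds gives `X_u = 0` and `X_x² g = T_t g'`
(`MapsBurgers.space_stationary`). What remains is an identity polynomial in `r = v_x`; splitting it
and differentiating repeatedly yields `T_t U = X_t + u X_x`, `T_t U_u = X_x`, `U_t = -u U_x` and
linearity of `U` in `(x, u)` (`IsAdmissible.determiningEqs`). This system is integrated by first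
integrals, each constant on the connected set `Ω`, and gives the six-parameter family
(`DeterminingEqs.solve`); the coefficient relation then becomes `g' = g / (αδ - βγ)`.

Conversely, a transformation of the family multiplies the Burgers expression by the nonzero factor
`(γt + δ)³ / (αδ - βγ)²`, whatever `g` is (`IsProjective.mapsBurgers`). Hence each one belongs to
the usual equivalence group, which gives normalization. The group contains nothing else: applied to
equations with constant coefficients, a usual equivalence induces admissible transformations, to
which the classification applies (`IsUsualEquivalence.exists_parameters`). -/

/-! ### Chain rules and partial derivatives -/

theorem ContDiffAt.eventually_differentiableAt {E F : Type*} [NormedAddCommGroup E]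
    [NormedSpace ℝ E] [NormedAddCommGroup F] [NormedSpace ℝ F] {f : E → F} {a : E}
    (hf : ContDiffAt ℝ ∞ f a) : ∀ᶠ b in 𝓝 a, DifferentiableAt ℝ f b := by
  have h1 : ContDiffAt ℝ 1 f a := hf.of_le (by norm_cast)
  filter_upwards [h1.eventually (by simp)] with b hb using hb.differentiableAt (by simp)

theorem ContDiffAt.differentiableAt_deriv {E : Type*} [NormedAddCommGroup E] [NormedSpace ℝ E]
    {f : ℝ → E} {s : ℝ} (hf : ContDiffAt ℝ ∞ f s) : DifferentiableAt ℝ (deriv f) s := by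
  have h1 : ContDiffAt ℝ 1 (fderiv ℝ f) s := hf.fderiv_right (m := 1) (by norm_cast)
  have h2 : ContDiffAt ℝ 1 (deriv f) s := h1.clm_apply contDiffAt_const
  exact h2.differentiableAt (by simp)

/-- Second-order chain rule along a curve. -/
theorem deriv_deriv_comp_curve {E : Type*} [NormedAddCommGroup E] [NormedSpace ℝ E]
    {f : E → ℝ} {c : ℝ → E} {s : ℝ} (hf : ContDiffAt ℝ ∞ f (c s)) (hc : ContDiffAt ℝ ∞ c s) :
    deriv (deriv fun z => f (c z)) s =
      fderiv ℝ (fderiv ℝ f) (c s) (deriv c s) (deriv c s) + fderiv ℝ f (c s) (deriv (deriv c) s) := by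
  have h1 : (deriv fun z => f (c z)) =ᶠ[𝓝 s] fun z => fderiv ℝ f (c z) (deriv c z) := by
    have hf' := hc.continuousAt.eventually hf.eventually_differentiableAt
    filter_upwards [hf', hc.eventually_differentiableAt] with z hz hz'
    exact (hz.hasFDerivAt.comp_hasDerivAt z hz'.hasDerivAt).deriv
  rw [h1.deriv_eq]
  have h2 : ContDiffAt ℝ 1 (fderiv ℝ f) (c s) :=
    hf.fderiv_right (m := 1) (by norm_cast)
  have h4 := (h2.differentiableAt (by simp)).hasFDerivAt.comp_hasDerivAt s
    (hc.differentiableAt (by simp)).hasDerivAt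
  exact (h4.clm_apply hc.differentiableAt_deriv.hasDerivAt).deriv

/-- Directional derivative of a function on the space of `(t, x, u)`. -/
noncomputable def pd (e : ℝ × ℝ × ℝ) (f : ℝ × ℝ × ℝ → ℝ) (p : ℝ × ℝ × ℝ) : ℝ := fderiv ℝ f p e

theorem deriv_fst_eq {v : ℝ × ℝ → ℝ} {q : ℝ × ℝ} (hv : DifferentiableAt ℝ v q) :
    deriv (fun t => v (t, q.2)) q.1 = fderiv ℝ v q (1, 0) :=
  (hv.hasFDerivAt.comp_hasDerivAt q.1
    ((hasDerivAt_id q.1).prodMk (hasDerivAt_const q.1 q.2))).deriv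

theorem deriv_snd_eq {v : ℝ × ℝ → ℝ} {q : ℝ × ℝ} (hv : DifferentiableAt ℝ v q) :
    deriv (fun x => v (q.1, x)) q.2 = fderiv ℝ v q (0, 1) :=
  (hv.hasFDerivAt.comp_hasDerivAt q.2
    ((hasDerivAt_const q.2 q.1).prodMk (hasDerivAt_id q.2))).deriv

theorem deriv_deriv_snd_eq {v : ℝ × ℝ → ℝ} {q : ℝ × ℝ} (hv : ContDiffAt ℝ ∞ v q) :
    deriv (deriv fun x => v (q.1, x)) q.2 = fderiv ℝ (fderiv ℝ v) q (0, 1) (0, 1) := by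
  have hc : ContDiff ℝ ∞ (fun x : ℝ => (q.1, x)) := contDiff_const.prodMk contDiff_id
  have h1 : deriv (fun x : ℝ => (q.1, x)) = fun _ => ((0 : ℝ), (1 : ℝ)) := by
    funext x
    exact ((hasDerivAt_const x q.1).prodMk (hasDerivAt_id x)).deriv
  have := deriv_deriv_comp_curve (f := v) (c := fun x : ℝ => (q.1, x)) (s := q.2) hv hc.contDiffAt
  rw [this, h1]
  simp

theorem clm_apply_prod (l : ℝ × ℝ →L[ℝ] ℝ) (a b : ℝ) : l (a, b) = a * l (1, 0) + b * l (0, 1) := by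
  have : ((a, b) : ℝ × ℝ) = a • (1, 0) + b • (0, 1) := by simp
  rw [this, map_add, map_smul, map_smul]; simp

theorem clm_apply_triple (l : ℝ × ℝ × ℝ →L[ℝ] ℝ) (a b c : ℝ) :
    l (a, b, c) = a * l (1, 0, 0) + b * l (0, 1, 0) + c * l (0, 0, 1) := by
  have : ((a, b, c) : ℝ × ℝ × ℝ) = a • (1, 0, 0) + b • (0, 1, 0) + c • (0, 0, 1) := by simp
  rw [this, map_add, map_add, map_smul, map_smul, map_smul]; simp

/-! ### Prolongation of a point transformation to second-order jets -/

section Prolongation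

variable {Φ : ℝ × ℝ × ℝ → ℝ × ℝ × ℝ} {v w : ℝ × ℝ → ℝ} {q : ℝ × ℝ}

theorem contDiffAt_graphPt (hv : ContDiffAt ℝ ∞ v q) : ContDiffAt ℝ ∞ (graphPt v) q :=
  contDiffAt_fst.prodMk (contDiffAt_snd.prodMk hv)

theorem contDiffAt_newIndep (hΦ : ContDiffAt ℝ ∞ Φ (graphPt v q)) (hv : ContDiffAt ℝ ∞ v q) :
    ContDiffAt ℝ ∞ (newIndep Φ v) q := by
  have := hΦ.comp q (contDiffAt_graphPt hv)
  exact this.fst.prodMk this.snd.fst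

theorem contDiffAt_newDep (hΦ : ContDiffAt ℝ ∞ Φ (graphPt v q)) (hv : ContDiffAt ℝ ∞ v q) :
    ContDiffAt ℝ ∞ (newDep Φ v) q :=
  (hΦ.comp q (contDiffAt_graphPt hv)).snd.snd

theorem hasFDerivAt_graphPt (hv : ContDiffAt ℝ ∞ v q) :
    HasFDerivAt (graphPt v) ((ContinuousLinearMap.fst ℝ ℝ ℝ).prod
      ((ContinuousLinearMap.snd ℝ ℝ ℝ).prod (fderiv ℝ v q))) q :=
  hasFDerivAt_fst.prodMk (hasFDerivAt_snd.prodMk (hv.differentiableAt (by simp)).hasFDerivAt)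

theorem fderiv_newIndep_apply (hΦ : ContDiffAt ℝ ∞ Φ (graphPt v q)) (hv : ContDiffAt ℝ ∞ v q)
    (ξ : ℝ × ℝ) :
    fderiv ℝ (newIndep Φ v) q ξ =
      (fderiv ℝ (fun p => (Φ p).1) (graphPt v q) (ξ.1, ξ.2, fderiv ℝ v q ξ),
       fderiv ℝ (fun p => (Φ p).2.1) (graphPt v q) (ξ.1, ξ.2, fderiv ℝ v q ξ)) := by
  have h1 := (hΦ.fst.differentiableAt (by simp)).hasFDerivAt.comp q (hasFDerivAt_graphPt hv)
  have h2 := (hΦ.snd.fst.differentiableAt (by simp)).hasFDerivAt.comp q (hasFDerivAt_graphPt hv)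
  rw [HasFDerivAt.fderiv (f := newIndep Φ v) (h1.prodMk h2)]
  simp

theorem fderiv_newDep_apply (hΦ : ContDiffAt ℝ ∞ Φ (graphPt v q)) (hv : ContDiffAt ℝ ∞ v q)
    (ξ : ℝ × ℝ) :
    fderiv ℝ (newDep Φ v) q ξ =
      fderiv ℝ (fun p => (Φ p).2.2) (graphPt v q) (ξ.1, ξ.2, fderiv ℝ v q ξ) := by
  have h2 := (hΦ.snd.snd.differentiableAt (by simp)).hasFDerivAt.comp q (hasFDerivAt_graphPt hv)
  rw [HasFDerivAt.fderiv (f := newDep Φ v) h2]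
  simp

/-- First-order prolongation. -/
theorem prolong_one (hΦ : ContDiffAt ℝ ∞ Φ (graphPt v q)) (hv : ContDiffAt ℝ ∞ v q)
    (hw : ContDiffAt ℝ ∞ w (newIndep Φ v q))
    (heq : ∀ᶠ r in 𝓝 q, w (newIndep Φ v r) = newDep Φ v r) (ξ : ℝ × ℝ) :
    fderiv ℝ (fun p => (Φ p).2.2) (graphPt v q) (ξ.1, ξ.2, fderiv ℝ v q ξ) =
      fderiv ℝ (fun p => (Φ p).1) (graphPt v q) (ξ.1, ξ.2, fderiv ℝ v q ξ) *
          fderiv ℝ w (newIndep Φ v q) (1, 0) +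
        fderiv ℝ (fun p => (Φ p).2.1) (graphPt v q) (ξ.1, ξ.2, fderiv ℝ v q ξ) *
          fderiv ℝ w (newIndep Φ v q) (0, 1) := by
  rw [← fderiv_newDep_apply hΦ hv, ← clm_apply_prod, ← fderiv_newIndep_apply hΦ hv]
  have h1 := (hw.differentiableAt (by simp)).hasFDerivAt.comp q
    ((contDiffAt_newIndep hΦ hv).differentiableAt (by simp)).hasFDerivAt
  have h2 : (w ∘ newIndep Φ v) =ᶠ[𝓝 q] newDep Φ v := heq
  rw [← h2.fderiv_eq, h1.fderiv]
  simp

/-- Second-order prolongation in a direction in which the new time is stationary. -/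
theorem prolong_two (hΦ : ContDiffAt ℝ ∞ Φ (graphPt v q)) (hv : ContDiffAt ℝ ∞ v q)
    (hw : ContDiffAt ℝ ∞ w (newIndep Φ v q))
    (heq : ∀ᶠ r in 𝓝 q, w (newIndep Φ v r) = newDep Φ v r) (ξ : ℝ × ℝ) (e : ℝ × ℝ × ℝ)
    (he : e = (ξ.1, ξ.2, fderiv ℝ v q ξ)) (b : ℝ) (hb : b = fderiv ℝ (fderiv ℝ v) q ξ ξ)
    (hT : fderiv ℝ (fun p => (Φ p).1) (graphPt v q) e = 0) :
    fderiv ℝ (fderiv ℝ fun p => (Φ p).2.2) (graphPt v q) e e +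
        b * fderiv ℝ (fun p => (Φ p).2.2) (graphPt v q) (0, 0, 1) =
      fderiv ℝ (fun p => (Φ p).2.1) (graphPt v q) e ^ 2 *
          fderiv ℝ (fderiv ℝ w) (newIndep Φ v q) (0, 1) (0, 1) +
        fderiv ℝ w (newIndep Φ v q) (1, 0) *
          (fderiv ℝ (fderiv ℝ fun p => (Φ p).1) (graphPt v q) e e +
            b * fderiv ℝ (fun p => (Φ p).1) (graphPt v q) (0, 0, 1)) +
        fderiv ℝ w (newIndep Φ v q) (0, 1) *
          (fderiv ℝ (fderiv ℝ fun p => (Φ p).2.1) (graphPt v q) e e +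
            b * fderiv ℝ (fun p => (Φ p).2.1) (graphPt v q) (0, 0, 1)) := by
  -- Everything is restricted to the line through `q` in direction `ξ`. Its lift `c` to the graph
  -- has velocity `e` and acceleration `(0, 0, b)` at `0`.
  set ℓ : ℝ → ℝ × ℝ := fun s => q + s • ξ with hℓ
  have hℓ0 : ℓ 0 = q := by simp [hℓ]
  have hℓc : ContDiff ℝ ∞ ℓ := contDiff_const.add (contDiff_id.smul contDiff_const)
  have hℓd : deriv ℓ = fun _ => ξ := by
    funext s
    have := ((hasDerivAt_id s).smul_const ξ).const_add q
    simpa [hℓ] using this.deriv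
  set c : ℝ → ℝ × ℝ × ℝ := fun s => graphPt v (ℓ s) with hcdef
  have hc0 : c 0 = graphPt v q := by simp [hcdef, hℓ0]
  have hvℓ : ContDiffAt ℝ ∞ v (ℓ 0) := by rwa [hℓ0]
  have hc : ContDiffAt ℝ ∞ c 0 := (contDiffAt_graphPt hvℓ).comp 0 hℓc.contDiffAt
  have hc1' : ∀ᶠ s in 𝓝 (0 : ℝ), deriv c s = (ξ.1, ξ.2, deriv (fun z => v (ℓ z)) s) := by
    have hev : ∀ᶠ s in 𝓝 (0 : ℝ), DifferentiableAt ℝ v (ℓ s) :=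
      hℓc.continuous.continuousAt.eventually hvℓ.eventually_differentiableAt
    filter_upwards [hev] with s hs
    have hl : HasDerivAt ℓ ξ s := by
      have := (hℓc.differentiable (by simp) s).hasDerivAt
      rwa [hℓd] at this
    have h3 := hs.hasFDerivAt.comp_hasDerivAt s hl
    have h1 : HasDerivAt (fun z => (ℓ z).1) ξ.1 s :=
      (hasFDerivAt_fst (𝕜 := ℝ) (p := ℓ s)).comp_hasDerivAt s hl
    have h2 : HasDerivAt (fun z => (ℓ z).2) ξ.2 s :=
      (hasFDerivAt_snd (𝕜 := ℝ) (p := ℓ s)).comp_hasDerivAt s hl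
    exact (h1.prodMk (h2.prodMk h3.differentiableAt.hasDerivAt)).deriv
  have hvl : ContDiffAt ℝ ∞ (fun z => v (ℓ z)) 0 := hvℓ.comp 0 hℓc.contDiffAt
  have hvd : deriv (fun z => v (ℓ z)) 0 = fderiv ℝ v q ξ := by
    have hl : HasDerivAt ℓ ξ 0 := by
      have := (hℓc.differentiable (by simp) 0).hasDerivAt
      rwa [hℓd] at this
    have := ((hvℓ.differentiableAt (by simp)).hasFDerivAt.comp_hasDerivAt 0 hl).deriv
    rwa [hℓ0] at this
  have hvdd : deriv (deriv fun z => v (ℓ z)) 0 = b := by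
    rw [deriv_deriv_comp_curve hvℓ hℓc.contDiffAt, hℓd, hℓ0]; simp [hb]
  have hc1 : deriv c 0 = e := by rw [hc1'.self_of_nhds, hvd, he]
  have hc2 : deriv (deriv c) 0 = (0, 0, b) := by
    have h1 : deriv c =ᶠ[𝓝 0] fun s => (ξ.1, ξ.2, deriv (fun z => v (ℓ z)) s) := hc1'
    rw [h1.deriv_eq]
    rw [← hvdd]
    exact ((hasDerivAt_const 0 ξ.1).prodMk ((hasDerivAt_const 0 ξ.2).prodMk
      hvl.differentiableAt_deriv.hasDerivAt)).deriv
  have hΦc : ContDiffAt ℝ ∞ Φ (c 0) := by rwa [hc0]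
  have key : ∀ F : ℝ × ℝ × ℝ → ℝ, ContDiffAt ℝ ∞ F (c 0) →
      deriv (deriv fun z => F (c z)) 0 = fderiv ℝ (fderiv ℝ F) (graphPt v q) e e +
        b * fderiv ℝ F (graphPt v q) (0, 0, 1) := by
    intro F hF
    rw [deriv_deriv_comp_curve hF hc, hc1, hc2, hc0]
    rw [clm_apply_triple _ 0 0 b]; ring
  have key1 : ∀ F : ℝ × ℝ × ℝ → ℝ, ContDiffAt ℝ ∞ F (c 0) →
      HasDerivAt (fun z => F (c z)) (fderiv ℝ F (graphPt v q) e) 0 := by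
    intro F hF
    have := (hF.differentiableAt (by simp)).hasFDerivAt.comp_hasDerivAt 0
      (hc.differentiableAt (by simp)).hasDerivAt
    rwa [hc1, hc0] at this
  have hT1 := key1 _ hΦc.fst
  have hX1 := key1 _ hΦc.snd.fst
  rw [← key _ hΦc.snd.snd, ← key _ hΦc.fst, ← key _ hΦc.snd.fst]
  have hcT : ContDiffAt ℝ ∞ (fun z => (Φ (c z)).1) 0 := hΦc.fst.comp 0 hc
  have hcX : ContDiffAt ℝ ∞ (fun z => (Φ (c z)).2.1) 0 := hΦc.snd.fst.comp 0 hc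
  set m : ℝ → ℝ × ℝ := fun s => ((Φ (c s)).1, (Φ (c s)).2.1) with hm
  have hmc : ContDiffAt ℝ ∞ m 0 := hcT.prodMk hcX
  have hm0 : m 0 = newIndep Φ v q := by simp [hm, newIndep, hc0]
  have hU : (fun z => (Φ (c z)).2.2) =ᶠ[𝓝 0] fun z => w (m z) := by
    have : Filter.Tendsto ℓ (𝓝 0) (𝓝 q) := by
      have := hℓc.continuous.tendsto 0
      rwa [hℓ0] at this
    filter_upwards [this.eventually heq] with z hz
    exact hz.symm
  have hdd : deriv (deriv fun z => (Φ (c z)).2.2) 0 = deriv (deriv fun z => w (m z)) 0 :=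
    hU.deriv.deriv_eq
  -- By `hT` the image curve starts purely in the new space direction, so the Hessian of `w`
  -- contributes only its second space derivative.
  have hm1 : deriv m 0 = (0, fderiv ℝ (fun p => (Φ p).2.1) (graphPt v q) e) := by
    rw [hT] at hT1
    exact (hT1.prodMk hX1).deriv
  have hm2 : deriv (deriv m) 0 =
      (deriv (deriv fun z => (Φ (c z)).1) 0, deriv (deriv fun z => (Φ (c z)).2.1) 0) := by
    have h1 : deriv m =ᶠ[𝓝 0]
        fun s => (deriv (fun z => (Φ (c z)).1) s, deriv (fun z => (Φ (c z)).2.1) s) := by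
      filter_upwards [hcT.eventually_differentiableAt, hcX.eventually_differentiableAt] with s h1 h2
      exact (h1.hasDerivAt.prodMk h2.hasDerivAt).deriv
    rw [h1.deriv_eq]
    exact (hcT.differentiableAt_deriv.hasDerivAt.prodMk hcX.differentiableAt_deriv.hasDerivAt).deriv
  rw [hdd, deriv_deriv_comp_curve (by rwa [hm0]) hmc, hm1, hm2, hm0]
  generalize fderiv ℝ (fun p => (Φ p).2.1) (graphPt v q) e = J
  rw [clm_apply_prod _ (deriv (deriv fun z => (Φ (c z)).1) 0),
    clm_apply_prod (fderiv ℝ (fderiv ℝ w) (newIndep Φ v q) (0, J))]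
  have hJ : ((0, J) : ℝ × ℝ) = J • (0, 1) := by simp
  rw [hJ, map_smul]
  simp only [smul_eq_mul, smul_apply]
  ring

end Prolongation

/-! ### Realizing jets by polynomials and reducing to algebra -/

/-- The polynomial with a prescribed 2-jet (without mixed second derivative) at `(t, x)`. -/
noncomputable def jetPoly (t x u p r a c : ℝ) (z : ℝ × ℝ) : ℝ :=
  u + p * (z.1 - t) + r * (z.2 - x) + a / 2 * (z.1 - t) ^ 2 + c / 2 * (z.2 - x) ^ 2

section JetPoly

variable (t x u p r a c : ℝ)

theorem contDiff_jetPoly : ContDiff ℝ ∞ (jetPoly t x u p r a c) := by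
  unfold jetPoly; fun_prop

theorem jetPoly_self : jetPoly t x u p r a c (t, x) = u := by simp [jetPoly]

theorem fderiv_jetPoly : fderiv ℝ (jetPoly t x u p r a c) = fun z =>
    (p + a * (z.1 - t)) • ContinuousLinearMap.fst ℝ ℝ ℝ +
      (r + c * (z.2 - x)) • ContinuousLinearMap.snd ℝ ℝ ℝ := by
  funext z
  have h1 : HasFDerivAt (fun z : ℝ × ℝ => z.1 - t) (ContinuousLinearMap.fst ℝ ℝ ℝ) z :=
    hasFDerivAt_fst.sub_const t
  have h2 : HasFDerivAt (fun z : ℝ × ℝ => z.2 - x) (ContinuousLinearMap.snd ℝ ℝ ℝ) z :=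
    hasFDerivAt_snd.sub_const x
  have := ((((h1.const_mul p).const_add u).add (h2.const_mul r)).add
    ((h1.pow 2).const_mul (a / 2))).add ((h2.pow 2).const_mul (c / 2))
  refine (HasFDerivAt.fderiv (f := jetPoly t x u p r a c) this).trans ?_
  ext <;> simp <;> ring

theorem fderiv_jetPoly_self (ξ : ℝ × ℝ) :
    fderiv ℝ (jetPoly t x u p r a c) (t, x) ξ = p * ξ.1 + r * ξ.2 := by
  rw [fderiv_jetPoly]; simp

theorem fderiv_fderiv_jetPoly (ξ : ℝ × ℝ) :
    fderiv ℝ (fderiv ℝ (jetPoly t x u p r a c)) (t, x) ξ ξ = a * ξ.1 ^ 2 + c * ξ.2 ^ 2 := by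
  rw [fderiv_jetPoly]
  have h1 : HasFDerivAt (fun z : ℝ × ℝ => p + a * (z.1 - t))
      (a • ContinuousLinearMap.fst ℝ ℝ ℝ) (t, x) :=
    ((hasFDerivAt_fst.sub_const t).const_mul a).const_add p
  have h2 : HasFDerivAt (fun z : ℝ × ℝ => r + c * (z.2 - x))
      (c • ContinuousLinearMap.snd ℝ ℝ ℝ) (t, x) :=
    ((hasFDerivAt_snd.sub_const x).const_mul c).const_add r
  have h3 := (h1.smul_const (ContinuousLinearMap.fst ℝ ℝ ℝ)).fun_add
    (h2.smul_const (ContinuousLinearMap.snd ℝ ℝ ℝ))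
  rw [h3.fderiv]
  simp
  ring

end JetPoly

/-- Where the new independent variables have nonzero Jacobian, the graph of a function is mapped to
the graph of a function. -/
theorem exists_newFunction {Φ : ℝ × ℝ × ℝ → ℝ × ℝ × ℝ} {v : ℝ × ℝ → ℝ} {q : ℝ × ℝ}
    (hΦ : ContDiffAt ℝ ∞ Φ (graphPt v q)) (hv : ContDiffAt ℝ ∞ v q)
    (hJ : (fderiv ℝ (newIndep Φ v) q).det ≠ 0) :
    ∃ w : ℝ × ℝ → ℝ, ContDiffAt ℝ ∞ w (newIndep Φ v q) ∧
      ∀ᶠ r in 𝓝 q, w (newIndep Φ v r) = newDep Φ v r := by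
  have hN := contDiffAt_newIndep hΦ hv
  set e := (fderiv ℝ (newIndep Φ v) q).toContinuousLinearEquivOfDetNeZero hJ with he
  have hd : HasFDerivAt (newIndep Φ v) (e : ℝ × ℝ →L[ℝ] ℝ × ℝ) q := by
    rw [he, ContinuousLinearMap.coe_toContinuousLinearEquivOfDetNeZero]
    exact (hN.differentiableAt (by simp)).hasFDerivAt
  have hs : HasStrictFDerivAt (newIndep Φ v) (e : ℝ × ℝ →L[ℝ] ℝ × ℝ) q :=
    hN.hasStrictFDerivAt' hd (by simp)
  refine ⟨fun y => newDep Φ v (hN.localInverse hd (by simp) y), ?_, ?_⟩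
  · have h1 := hN.to_localInverse hd (by simp)
    have h2 := contDiffAt_newDep hΦ hv
    rw [← hN.localInverse_apply_image hd (by simp)] at h2
    exact h2.comp (newIndep Φ v q) h1
  · filter_upwards [hs.eventually_left_inverse] with r hr
    exact congrArg (newDep Φ v) hr

theorem det_ne_zero_of_injective {E : Type*} [NormedAddCommGroup E] [NormedSpace ℝ E]
    [FiniteDimensional ℝ E] {l : E →L[ℝ] E} (h : ∀ z, l z = 0 → z = 0) : l.det ≠ 0 := by
  have h1 : LinearMap.ker (l : E →ₗ[ℝ] E) = ⊥ := by
    rw [LinearMap.ker_eq_bot']; exact h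
  have h2 := LinearMap.isUnit_iff_ker_eq_bot (l : E →ₗ[ℝ] E) |>.2 h1
  exact (LinearMap.isUnit_iff_isUnit_det _ |>.1 h2).ne_zero

theorem surjective_of_det_ne_zero {E : Type*} [NormedAddCommGroup E] [NormedSpace ℝ E]
    [FiniteDimensional ℝ E] {l : E →L[ℝ] E} (h : l.det ≠ 0) : Function.Surjective l := by
  intro y
  refine ⟨(l.toContinuousLinearEquivOfDetNeZero h).symm y, ?_⟩
  have := (l.toContinuousLinearEquivOfDetNeZero h).apply_symm_apply y
  rwa [ContinuousLinearMap.toContinuousLinearEquivOfDetNeZero_apply] at this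

/-- The content of `MapsBurgers` for single jets. -/
theorem MapsBurgers.jet {Ω : Set (ℝ × ℝ × ℝ)} {Φ : ℝ × ℝ × ℝ → ℝ × ℝ × ℝ} {g g' : ℝ → ℝ}
    (hm : MapsBurgers Ω Φ g g') {t x u : ℝ} (hΩ : (t, x, u) ∈ Ω)
    (hΦ : ContDiffAt ℝ ∞ Φ (t, x, u)) (p r a c : ℝ)
    {DT DX DU : ℝ × ℝ × ℝ →L[ℝ] ℝ}
    (hDT : DT = fderiv ℝ (fun p => (Φ p).1) (t, x, u))
    (hDX : DX = fderiv ℝ (fun p => (Φ p).2.1) (t, x, u))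
    (hDU : DU = fderiv ℝ (fun p => (Φ p).2.2) (t, x, u))
    (hJ : DT (1, 0, p) * DX (0, 1, r) - DT (0, 1, r) * DX (1, 0, p) ≠ 0) :
    ∃ P R W : ℝ, DU (1, 0, p) = DT (1, 0, p) * P + DX (1, 0, p) * R ∧
      DU (0, 1, r) = DT (0, 1, r) * P + DX (0, 1, r) * R ∧
      (∀ (ξ₁ ξ₂ : ℝ) (e : ℝ × ℝ × ℝ), e = (ξ₁, ξ₂, p * ξ₁ + r * ξ₂) → DT e = 0 →
        fderiv ℝ (fderiv ℝ fun p => (Φ p).2.2) (t, x, u) e e +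
          (a * ξ₁ ^ 2 + c * ξ₂ ^ 2) * DU (0, 0, 1) =
        DX e ^ 2 * W + P * (fderiv ℝ (fderiv ℝ fun p => (Φ p).1) (t, x, u) e e +
          (a * ξ₁ ^ 2 + c * ξ₂ ^ 2) * DT (0, 0, 1)) +
        R * (fderiv ℝ (fderiv ℝ fun p => (Φ p).2.1) (t, x, u) e e +
          (a * ξ₁ ^ 2 + c * ξ₂ ^ 2) * DX (0, 0, 1))) ∧
      (p + u * r = g t * c ↔ P + (Φ (t, x, u)).2.2 * R = g' (Φ (t, x, u)).1 * W) := by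
  subst hDT hDX hDU
  set v := jetPoly t x u p r a c with hv
  have hgr : graphPt v (t, x) = (t, x, u) := by simp [graphPt, hv, jetPoly_self]
  have hvc : ContDiffAt ℝ ∞ v (t, x) := (contDiff_jetPoly t x u p r a c).contDiffAt
  have hΦ' : ContDiffAt ℝ ∞ Φ (graphPt v (t, x)) := by rwa [hgr]
  have hv1 : ∀ ξ, fderiv ℝ v (t, x) ξ = p * ξ.1 + r * ξ.2 := fderiv_jetPoly_self t x u p r a c
  have hv2 : ∀ ξ, fderiv ℝ (fderiv ℝ v) (t, x) ξ ξ = a * ξ.1 ^ 2 + c * ξ.2 ^ 2 :=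
    fderiv_fderiv_jetPoly t x u p r a c
  have hdet : (fderiv ℝ (newIndep Φ v) (t, x)).det ≠ 0 := by
    apply det_ne_zero_of_injective
    rintro ⟨z₁, z₂⟩ hz
    rw [fderiv_newIndep_apply hΦ' hvc, hv1, hgr, Prod.mk_eq_zero] at hz
    obtain ⟨h1, h2⟩ := hz
    simp only at h1 h2
    rw [clm_apply_triple] at h1 h2
    rw [clm_apply_triple _ 1 0 p, clm_apply_triple _ 0 1 r, clm_apply_triple _ 1 0 p,
      clm_apply_triple _ 0 1 r] at hJ
    generalize fderiv ℝ (fun p => (Φ p).1) (t, x, u) = DT at *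
    generalize fderiv ℝ (fun p => (Φ p).2.1) (t, x, u) = DX at *
    -- Cramer's rule for the total Jacobian, whose determinant is nonzero by `hJ`.
    have e1 : z₁ = 0 := by
      refine (mul_eq_zero.1 ?_).resolve_right hJ
      linear_combination h1 * (DX (0, 1, 0) + r * DX (0, 0, 1)) -
        h2 * (DT (0, 1, 0) + r * DT (0, 0, 1))
    have e2 : z₂ = 0 := by
      refine (mul_eq_zero.1 ?_).resolve_right hJ
      linear_combination -h1 * (DX (1, 0, 0) + p * DX (0, 0, 1)) +
        h2 * (DT (1, 0, 0) + p * DT (0, 0, 1))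
    rw [e1, e2]; rfl
  obtain ⟨w, hw, hweq⟩ := exists_newFunction hΦ' hvc hdet
  have hsat := hm v w (t, x) (by rwa [hgr]) hvc hdet hw hweq
  have hN : newIndep Φ v (t, x) = ((Φ (t, x, u)).1, (Φ (t, x, u)).2.1) := by
    simp only [newIndep, hgr]
  have hwU : w (newIndep Φ v (t, x)) = (Φ (t, x, u)).2.2 := by
    rw [hweq.self_of_nhds, newDep, hgr]
  have hone := prolong_one hΦ' hvc hw hweq
  have htwo := prolong_two hΦ' hvc hw hweq
  have hv0 : v (t, x) = u := jetPoly_self t x u p r a c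
  rw [SatisfiesBurgersAt, SatisfiesBurgersAt, deriv_fst_eq (hvc.differentiableAt (by simp)),
    deriv_snd_eq (hvc.differentiableAt (by simp)), deriv_deriv_snd_eq hvc,
    deriv_fst_eq (hw.differentiableAt (by simp)), deriv_snd_eq (hw.differentiableAt (by simp)),
    deriv_deriv_snd_eq hw, hwU, hv1, hv1, hv2, hv0] at hsat
  rw [hgr] at hone htwo
  refine ⟨fderiv ℝ w (newIndep Φ v (t, x)) (1, 0), fderiv ℝ w (newIndep Φ v (t, x)) (0, 1),
    fderiv ℝ (fderiv ℝ w) (newIndep Φ v (t, x)) (0, 1) (0, 1), ?_, ?_, ?_, ?_⟩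
  · simpa [hv1] using hone (1, 0)
  · simpa [hv1] using hone (0, 1)
  · intro ξ₁ ξ₂ e he hT
    exact htwo (ξ₁, ξ₂) e (by rw [he, hv1]) _ (hv2 (ξ₁, ξ₂)).symm hT
  · have h1 : (newIndep Φ v (t, x)).1 = (Φ (t, x, u)).1 := by rw [hN]
    rw [h1] at hsat
    simpa using hsat

/-! ### Partial derivatives on open subsets of the space of `(t, x, u)` -/

section Partials

variable {Ω : Set (ℝ × ℝ × ℝ)} {f f' : ℝ × ℝ × ℝ → ℝ} {p : ℝ × ℝ × ℝ} {e : ℝ × ℝ × ℝ}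

theorem pd_congr (hΩ : IsOpen Ω) (h : ∀ p ∈ Ω, f p = f' p) (hp : p ∈ Ω) : pd e f p = pd e f' p := by
  have : f =ᶠ[𝓝 p] f' := by filter_upwards [hΩ.mem_nhds hp] with r hr using h r hr
  rw [pd, pd, this.fderiv_eq]

theorem pd_const (a : ℝ) : pd e (fun _ => a) p = 0 := by simp [pd]

theorem pd_of_eq_const (hΩ : IsOpen Ω) {a : ℝ} (h : ∀ p ∈ Ω, f p = a) (hp : p ∈ Ω) :
    pd e f p = 0 := by
  rw [pd_congr hΩ h hp, pd_const]

theorem pd_time : pd e (fun p => p.1) p = e.1 := by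
  simp [pd, fderiv_fst]

theorem pd_space : pd e (fun p => p.2.1) p = e.2.1 := by
  have : HasFDerivAt (fun p : ℝ × ℝ × ℝ => p.2.1)
    ((ContinuousLinearMap.fst ℝ ℝ ℝ).comp (ContinuousLinearMap.snd ℝ ℝ (ℝ × ℝ))) p :=
    hasFDerivAt_fst.comp p hasFDerivAt_snd
  rw [pd, this.fderiv]; simp

theorem pd_value : pd e (fun p => p.2.2) p = e.2.2 := by
  have : HasFDerivAt (fun p : ℝ × ℝ × ℝ => p.2.2)
    ((ContinuousLinearMap.snd ℝ ℝ ℝ).comp (ContinuousLinearMap.snd ℝ ℝ (ℝ × ℝ))) p :=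
    hasFDerivAt_snd.comp p hasFDerivAt_snd
  rw [pd, this.fderiv]; simp

theorem pd_add (hf : DifferentiableAt ℝ f p) (hf' : DifferentiableAt ℝ f' p) :
    pd e (fun p => f p + f' p) p = pd e f p + pd e f' p := by
  rw [pd, fderiv_fun_add hf hf']; simp [pd]

theorem pd_sub (hf : DifferentiableAt ℝ f p) (hf' : DifferentiableAt ℝ f' p) :
    pd e (fun p => f p - f' p) p = pd e f p - pd e f' p := by
  rw [pd, fderiv_fun_sub hf hf']; simp [pd]

theorem pd_mul (hf : DifferentiableAt ℝ f p) (hf' : DifferentiableAt ℝ f' p) :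
    pd e (fun p => f p * f' p) p = f p * pd e f' p + f' p * pd e f p := by
  rw [pd, fderiv_fun_mul hf hf']; simp [pd]

theorem pd_comp {h : ℝ → ℝ} (hh : DifferentiableAt ℝ h (f p)) (hf : DifferentiableAt ℝ f p) :
    pd e (fun p => h (f p)) p = deriv h (f p) * pd e f p := by
  have := hh.hasDerivAt.comp_hasFDerivAt p hf.hasFDerivAt
  rw [pd, HasFDerivAt.fderiv (f := fun p => h (f p)) this]; simp [pd]

theorem ContDiffOn.differentiableAt_of_isOpen (hf : ContDiffOn ℝ ∞ f Ω) (hΩ : IsOpen Ω)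
    (hp : p ∈ Ω) : DifferentiableAt ℝ f p :=
  (hf.contDiffAt (hΩ.mem_nhds hp)).differentiableAt (by simp)

theorem contDiffOn_pd (hΩ : IsOpen Ω) (hf : ContDiffOn ℝ ∞ f Ω) : ContDiffOn ℝ ∞ (pd e f) Ω :=
  (hf.fderiv_of_isOpen hΩ (m := ∞) (by simp)).clm_apply contDiffOn_const

theorem fderiv_fderiv_eq_pd (hΩ : IsOpen Ω) (hf : ContDiffOn ℝ ∞ f Ω) (hp : p ∈ Ω)
    (e e' : ℝ × ℝ × ℝ) : fderiv ℝ (fderiv ℝ f) p e e' = pd e (pd e' f) p := by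
  have h1 : DifferentiableAt ℝ (fderiv ℝ f) p :=
    ((hf.fderiv_of_isOpen hΩ (m := ∞) (by simp)).contDiffAt (hΩ.mem_nhds hp)).differentiableAt
      (by simp)
  have := h1.hasFDerivAt.clm_apply (hasFDerivAt_const e' p)
  rw [pd, HasFDerivAt.fderiv (f := pd e' f) this]
  simp

theorem pd_comm (hΩ : IsOpen Ω) (hf : ContDiffOn ℝ ∞ f Ω) (hp : p ∈ Ω) (e e' : ℝ × ℝ × ℝ) :
    pd e (pd e' f) p = pd e' (pd e f) p := by
  rw [← fderiv_fderiv_eq_pd hΩ hf hp, ← fderiv_fderiv_eq_pd hΩ hf hp]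
  exact ((hf.contDiffAt (hΩ.mem_nhds hp)).isSymmSndFDerivAt (by simp; norm_cast)).eq e e'

theorem fderiv_fderiv_spatial (hΩ : IsOpen Ω) (hf : ContDiffOn ℝ ∞ f Ω) (hp : p ∈ Ω) (r : ℝ) :
    fderiv ℝ (fderiv ℝ f) p (0, 1, r) (0, 1, r) =
      pd (0, 1, 0) (pd (0, 1, 0) f) p + 2 * r * pd (0, 1, 0) (pd (0, 0, 1) f) p +
        r ^ 2 * pd (0, 0, 1) (pd (0, 0, 1) f) p := by
  have h : ((0, 1, r) : ℝ × ℝ × ℝ) = (0, 1, 0) + r • (0, 0, 1) := by simp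
  rw [h]
  simp only [map_add, map_smul, add_apply, smul_apply, smul_eq_mul]
  rw [fderiv_fderiv_eq_pd hΩ hf hp, fderiv_fderiv_eq_pd hΩ hf hp, fderiv_fderiv_eq_pd hΩ hf hp,
    fderiv_fderiv_eq_pd hΩ hf hp, pd_comm hΩ hf hp (0, 0, 1) (0, 1, 0)]
  ring

/-- The only integration device of the proof. Working with first integrals in all three variables
needs just connectedness of `Ω`, with no assumption on its slices. -/
theorem exists_const_of_pd (hΩ : IsOpen Ω) (hc : IsConnected Ω) (hf : ContDiffOn ℝ ∞ f Ω)
    (ht : ∀ p ∈ Ω, pd (1, 0, 0) f p = 0) (hx : ∀ p ∈ Ω, pd (0, 1, 0) f p = 0)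
    (hu : ∀ p ∈ Ω, pd (0, 0, 1) f p = 0) : ∃ a, ∀ p ∈ Ω, f p = a := by
  obtain ⟨q, hq⟩ := hc.nonempty
  refine ⟨f q, fun p hp => ?_⟩
  refine hΩ.is_const_of_fderiv_eq_zero hc.isPreconnected
    (fun r hr => (hf.differentiableAt_of_isOpen hΩ hr).differentiableWithinAt) ?_ hp hq
  intro r hr
  refine ContinuousLinearMap.ext fun z => ?_
  obtain ⟨a, b, c⟩ := z
  have h1 : fderiv ℝ f r (1, 0, 0) = 0 := ht r hr
  have h2 : fderiv ℝ f r (0, 1, 0) = 0 := hx r hr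
  have h3 : fderiv ℝ f r (0, 0, 1) = 0 := hu r hr
  rw [clm_apply_triple, h1, h2, h3]; simp

end Partials

/-! ### Algebraic consequences at a single point -/

section Pointwise

theorem clm_apply_time (l : ℝ × ℝ × ℝ →L[ℝ] ℝ) (b : ℝ) :
    l (1, 0, b) = l (1, 0, 0) + b * l (0, 0, 1) := by
  rw [clm_apply_triple]; ring

theorem clm_apply_space (l : ℝ × ℝ × ℝ →L[ℝ] ℝ) (b : ℝ) :
    l (0, 1, b) = l (0, 1, 0) + b * l (0, 0, 1) := by
  rw [clm_apply_triple]; ring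

variable {Ω : Set (ℝ × ℝ × ℝ)} {Φ : ℝ × ℝ × ℝ → ℝ × ℝ × ℝ} {g g' : ℝ → ℝ}

/-- The form in which the nonvanishing Jacobian is used: evaluating a linear relation between `dT`,
`dX`, `dU` on dual vectors produces `1 = 0`. -/
theorem exists_dual_basis {p : ℝ × ℝ × ℝ} (hΦ : ContDiffAt ℝ ∞ Φ p)
    (hdet : (fderiv ℝ Φ p).det ≠ 0) (y : ℝ × ℝ × ℝ) :
    ∃ h, fderiv ℝ (fun p => (Φ p).1) p h = y.1 ∧ fderiv ℝ (fun p => (Φ p).2.1) p h = y.2.1 ∧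
      fderiv ℝ (fun p => (Φ p).2.2) p h = y.2.2 := by
  obtain ⟨h, hh⟩ := surjective_of_det_ne_zero hdet y
  have h1 := (hΦ.fst.differentiableAt (by simp)).hasFDerivAt
  have h2 := (hΦ.snd.fst.differentiableAt (by simp)).hasFDerivAt
  have h3 := (hΦ.snd.snd.differentiableAt (by simp)).hasFDerivAt
  rw [HasFDerivAt.fderiv (f := Φ) (h1.prodMk (h2.prodMk h3))] at hh
  refine ⟨h, ?_⟩
  rw [← hh]
  simp

/-- The new time does not depend on `x` and `u`. -/
theorem MapsBurgers.time_stationary (hm : MapsBurgers Ω Φ g g') {t x u : ℝ} (hΩ : (t, x, u) ∈ Ω)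
    (hΦ : ContDiffAt ℝ ∞ Φ (t, x, u)) (hdet : (fderiv ℝ Φ (t, x, u)).det ≠ 0) (hg : g t ≠ 0)
    (hg' : g' (Φ (t, x, u)).1 ≠ 0) :
    fderiv ℝ (fun p => (Φ p).1) (t, x, u) (0, 1, 0) = 0 ∧
      fderiv ℝ (fun p => (Φ p).1) (t, x, u) (0, 0, 1) = 0 := by
  obtain ⟨⟨a₁, a₂, a₃⟩, hT1, hX1, -⟩ := exists_dual_basis hΦ hdet (1, 0, 0)
  obtain ⟨⟨b₁, b₂, b₃⟩, hT2, hX2, -⟩ := exists_dual_basis hΦ hdet (0, 1, 0)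
  obtain ⟨⟨c₁, c₂, c₃⟩, hT3, hX3, hU3⟩ := exists_dual_basis hΦ hdet (0, 0, 1)
  have key := fun p r a c => hm.jet hΩ hΦ p r a c rfl rfl rfl
  generalize fderiv ℝ (fun p => (Φ p).1) (t, x, u) = DT at *
  generalize fderiv ℝ (fun p => (Φ p).2.1) (t, x, u) = DX at *
  generalize fderiv ℝ (fun p => (Φ p).2.2) (t, x, u) = DU at *
  rw [clm_apply_triple] at hT1 hT2 hT3 hX1 hX2 hX3 hU3
  have main : ∀ p r, DT (1, 0, p) * DX (0, 1, r) - DT (0, 1, r) * DX (1, 0, p) ≠ 0 →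
      DT (0, 1, r) = 0 := by
    intro p r hJ
    -- Two jets of solutions differing only in `v_tt` (`0` and `1`). The new first derivatives `P`,
    -- `R` agree because they depend on first-order data only, and the target equation then makes
    -- the new second space derivatives agree.
    obtain ⟨P, R, W, h1, h2, h3, h4⟩ := key p r 0 ((p + u * r) / g t) hJ
    obtain ⟨P', R', W', h1', h2', h3', h4'⟩ := key p r 1 ((p + u * r) / g t) hJ
    have hP : P' = P := by
      refine mul_left_cancel₀ hJ ?_
      linear_combination DX (0, 1, r) * (h1 - h1') - DX (1, 0, p) * (h2 - h2')
    have hR : R' = R := by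
      refine mul_left_cancel₀ hJ ?_
      linear_combination -DT (0, 1, r) * (h1 - h1') + DT (1, 0, p) * (h2 - h2')
    subst hP hR
    have hc : p + u * r = g t * ((p + u * r) / g t) := by field_simp
    have hW : W = W' := mul_left_cancel₀ hg' ((h4.1 hc).symm.trans (h4'.1 hc))
    subst hW
    -- This direction is tangent to the graph and annihilated by `dT`. Its `t`-component is `-(T_x +
    -- r T_u)`, so the change of `v_tt` is seen with the factor `(T_x + r T_u)²`.
    have hDT : DT (-DT (0, 1, r), DT (1, 0, p), p * -DT (0, 1, r) + r * DT (1, 0, p)) = 0 := by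
      rw [clm_apply_triple, clm_apply_triple DT 0 1 r, clm_apply_triple DT 1 0 p]; ring
    have h5 := h3 _ _ _ rfl hDT
    have h5' := h3' _ _ _ rfl hDT
    have h6 : DT (0, 1, r) ^ 2 * (DU (0, 0, 1) - P' * DT (0, 0, 1) - R' * DX (0, 0, 1)) = 0 := by
      linear_combination h5' - h5
    rcases mul_eq_zero.1 h6 with h7 | h7
    · exact pow_eq_zero_iff (two_ne_zero) |>.1 h7
    · exfalso
      -- Otherwise `dU = P dT + R dX`, contradicting independence of the three differentials.
      rw [clm_apply_triple _ 1 0 p, clm_apply_triple _ 1 0 p, clm_apply_triple _ 1 0 p] at h1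
      rw [clm_apply_triple _ 0 1 r, clm_apply_triple _ 0 1 r, clm_apply_triple _ 0 1 r] at h2
      have : (1 : ℝ) = 0 := by
        linear_combination -hU3 + c₁ * h1 + c₂ * h2 + (c₃ - c₁ * p - c₂ * r) * h7 + P' * hT3 +
          R' * hX3
      exact one_ne_zero this
  have eT1 := clm_apply_time DT
  have eT2 := clm_apply_space DT
  have eX1 := clm_apply_time DX
  have eX2 := clm_apply_space DX
  clear key
  generalize DT (1, 0, 0) = Tt at *
  generalize DT (0, 1, 0) = Tx at *
  generalize DT (0, 0, 1) = Tu at *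
  generalize DX (1, 0, 0) = Xt at *
  generalize DX (0, 1, 0) = Xx at *
  generalize DX (0, 0, 1) = Xu at *
  simp only [eT1, eT2, eX1, eX2] at main
  set A := Tt * Xx - Tx * Xt with hA
  set B := Tu * Xx - Tx * Xu with hB
  set C := Tt * Xu - Tu * Xt with hC
  have main' : ∀ p r, A + B * p + C * r ≠ 0 → Tx + r * Tu = 0 := by
    intro p r h
    have := main p r (by convert h using 1; rw [hA, hB, hC]; ring)
    linear_combination this
  -- `A`, `B`, `C` are up to sign the 2×2 minors of `(dT, dX)`, which cannot all vanish.
  have hex : ∃ p r, A + B * p + C * r ≠ 0 := by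
    by_contra! hcon
    have h0 := hcon 0 0
    have h1 := hcon 1 0
    have h2 := hcon 0 1
    have hA0 : A = 0 := by linear_combination h0
    have hB0 : B = 0 := by linear_combination h1 - h0
    have hC0 : C = 0 := by linear_combination h2 - h0
    rw [hA] at hA0
    rw [hB] at hB0
    rw [hC] at hC0
    have : (1 : ℝ) = 0 := by
      simp only at hT1 hT2 hX1 hX2
      have e1 : (a₁ * Tt + a₂ * Tx + a₃ * Tu) * (b₁ * Xt + b₂ * Xx + b₃ * Xu) -
          (b₁ * Tt + b₂ * Tx + b₃ * Tu) * (a₁ * Xt + a₂ * Xx + a₃ * Xu) = 0 := by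
        linear_combination (a₁ * b₂ - a₂ * b₁) * hA0 + (a₃ * b₂ - a₂ * b₃) * hB0 +
          (a₁ * b₃ - a₃ * b₁) * hC0
      rw [hT1, hT2, hX1, hX2] at e1
      linarith
    exact one_ne_zero this
  obtain ⟨p, r, hpr⟩ := hex
  -- An affine function vanishing at `r + 1` and `r + 2` would vanish at `r` too. Two values of `r`
  -- separate `T_x` from `T_u`.
  have hex' : ∃ r', r' ≠ r ∧ A + B * p + C * r' ≠ 0 := by
    by_cases h : A + B * p + C * (r + 1) = 0
    · refine ⟨r + 2, by simp, fun h' => hpr ?_⟩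
      linear_combination 2 * h - h'
    · exact ⟨r + 1, by simp, h⟩
  obtain ⟨r', hne, hpr'⟩ := hex'
  have e1 := main' p r hpr
  have e2 := main' p r' hpr'
  have hTu : Tu = 0 := by
    have : (r' - r) * Tu = 0 := by linear_combination e2 - e1
    exact (mul_eq_zero.1 this).resolve_left (sub_ne_zero.2 hne)
  refine ⟨?_, hTu⟩
  rw [hTu] at e1; linarith

/-- Consequences of `MapsBurgers` at a point near which the new time does not depend
on `x` and `u`. -/
theorem MapsBurgers.space_stationary (hm : MapsBurgers Ω Φ g g') {t x u : ℝ} (hΩ : (t, x, u) ∈ Ω)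
    (hΦ : ContDiffAt ℝ ∞ Φ (t, x, u)) (hdet : (fderiv ℝ Φ (t, x, u)).det ≠ 0) (hg : g t ≠ 0)
    {DT DX DU : ℝ × ℝ × ℝ →L[ℝ] ℝ}
    (hDT : DT = fderiv ℝ (fun p => (Φ p).1) (t, x, u))
    (hDX : DX = fderiv ℝ (fun p => (Φ p).2.1) (t, x, u))
    (hDU : DU = fderiv ℝ (fun p => (Φ p).2.2) (t, x, u))
    (hTx : DT (0, 1, 0) = 0) (hTu : DT (0, 0, 1) = 0)
    (hTT : ∀ r, fderiv ℝ (fderiv ℝ fun p => (Φ p).1) (t, x, u) (0, 1, r) (0, 1, r) = 0) :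
    DT (1, 0, 0) ≠ 0 ∧ DX (0, 0, 1) = 0 ∧ DX (0, 1, 0) ≠ 0 ∧ DU (0, 0, 1) ≠ 0 ∧
      DX (0, 1, 0) ^ 2 * g t = DT (1, 0, 0) * g' (Φ (t, x, u)).1 ∧
      ∀ r, DX (0, 1, 0) * DU (1, 0, 0) +
          (DT (1, 0, 0) * (Φ (t, x, u)).2.2 - DX (1, 0, 0)) * (DU (0, 1, 0) + r * DU (0, 0, 1)) =
        g t * (DX (0, 1, 0) *
            fderiv ℝ (fderiv ℝ fun p => (Φ p).2.2) (t, x, u) (0, 1, r) (0, 1, r) -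
          (DU (0, 1, 0) + r * DU (0, 0, 1)) *
            fderiv ℝ (fderiv ℝ fun p => (Φ p).2.1) (t, x, u) (0, 1, r) (0, 1, r)) +
          DX (0, 1, 0) * (u * r * DU (0, 0, 1)) := by
  obtain ⟨⟨a₁, a₂, a₃⟩, hT1, hX1, -⟩ := exists_dual_basis hΦ hdet (1, 0, 0)
  obtain ⟨⟨b₁, b₂, b₃⟩, hT2, hX2, -⟩ := exists_dual_basis hΦ hdet (0, 1, 0)
  obtain ⟨⟨c₁, c₂, c₃⟩, hT3, hX3, hU3⟩ := exists_dual_basis hΦ hdet (0, 0, 1)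
  have key := fun p r a c => hm.jet hΩ hΦ p r a c hDT hDX hDU
  rw [← hDT, clm_apply_triple, hTx, hTu] at hT1 hT2 hT3
  rw [← hDX, clm_apply_triple] at hX1 hX2 hX3
  rw [← hDU, clm_apply_triple] at hU3
  clear hDT hDX hDU
  simp only [mul_zero, add_zero] at hT1 hT2 hT3 hX1 hX2 hX3 hU3
  have eT1 : ∀ b, DT (1, 0, b) = DT (1, 0, 0) := fun b => by rw [clm_apply_time, hTu]; ring
  have eT2 : ∀ b, DT (0, 1, b) = 0 := fun b => by rw [clm_apply_space, hTx, hTu]; ring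
  have eX1 := clm_apply_time DX
  have eX2 := clm_apply_space DX
  have eU1 := clm_apply_time DU
  have eU2 := clm_apply_space DU
  have hTt : DT (1, 0, 0) ≠ 0 := by
    intro h; rw [h] at hT1; simp at hT1
  have hc₁ : c₁ = 0 := (mul_eq_zero.1 hT3).resolve_right hTt
  have hb₁ : b₁ = 0 := (mul_eq_zero.1 hT2).resolve_right hTt
  subst hc₁ hb₁
  generalize hU : (Φ (t, x, u)).2.2 = V at *
  generalize hG : g' (Φ (t, x, u)).1 = G at *
  generalize hHU : fderiv ℝ (fderiv ℝ fun p => (Φ p).2.2) (t, x, u) = HU at *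
  generalize hHX : fderiv ℝ (fderiv ℝ fun p => (Φ p).2.1) (t, x, u) = HX at *
  generalize hHT : fderiv ℝ (fderiv ℝ fun p => (Φ p).1) (t, x, u) = HT at *
  generalize DT (1, 0, 0) = Tt at *
  generalize DX (1, 0, 0) = Xt at *
  generalize DX (0, 1, 0) = Xx at *
  generalize DX (0, 0, 1) = Xu at *
  generalize DU (1, 0, 0) = Ut at *
  generalize DU (0, 1, 0) = Ux at *
  generalize DU (0, 0, 1) = Uu at *
  simp only [eT1, eT2, eX1, eX2, eU1, eU2, hTu] at key
  -- The pure `x`-direction now leaves the new time stationary. With `v_xx = (p + u r) / g` the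
  -- source equation holds, and `P` and `W` are eliminated through the target equation.
  have main : ∀ p r, Xx + r * Xu ≠ 0 → ∃ R, Ux + r * Uu = (Xx + r * Xu) * R ∧
      (Xx + r * Xu) ^ 2 * (Ut + p * Uu - R * (Xt + p * Xu) + Tt * V * R) =
        Tt * G * (HU (0, 1, r) (0, 1, r) - R * HX (0, 1, r) (0, 1, r) +
          (p + u * r) / g t * (Uu - R * Xu)) := by
    intro p r hmne
    obtain ⟨P, R, W, h1, h2, h3, h4⟩ := key p r 0 ((p + u * r) / g t) (by
      simpa using ⟨hTt, hmne⟩)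
    refine ⟨R, by linear_combination h2, ?_⟩
    have h5 := h3 0 1 (0, 1, r) (by simp) (eT2 r)
    rw [eX2, hTT] at h5
    have h6 := h4.1 (by field_simp)
    linear_combination (Xx + r * Xu) ^ 2 * h1 + Tt * (Xx + r * Xu) ^ 2 * h6 - Tt * G * h5
  -- `R` does not depend on `p`, so `main` is affine in `p`; comparing `p = 0` and `p = 1` isolates
  -- the slope, whose common factor `Uu - R Xu` is nonzero by independence of the differentials.
  have hsq : ∀ r, Xx + r * Xu ≠ 0 → (Xx + r * Xu) ^ 2 * g t = Tt * G := by
    intro r hmne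
    obtain ⟨R, h1, h2⟩ := main 0 r hmne
    obtain ⟨R', h1', h2'⟩ := main 1 r hmne
    have hR : R' = R := mul_left_cancel₀ hmne (h1'.symm.trans h1)
    subst hR
    have hκ : Uu - R' * Xu ≠ 0 := by
      intro h
      have : (1 : ℝ) = 0 := by
        linear_combination -hU3 + c₂ * h1 + R' * hX3 + (c₃ - c₂ * r) * h
      exact one_ne_zero this
    refine mul_left_cancel₀ hκ ?_
    field_simp at h2 h2'
    linear_combination h2' - h2
  have hXu0 : Xu = 0 := by
    by_contra h
    -- If `Xu ≠ 0`, then `r` can be chosen with `Xx + r Xu` equal to `1` or `2`, so that `g = 4g`.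
    have e1 := hsq ((1 - Xx) / Xu) (by field_simp; simp)
    have e2 := hsq ((2 - Xx) / Xu) (by field_simp; simp)
    field_simp at e1 e2
    have : g t = 0 := by linear_combination (e2 - e1) / 3
    exact hg this
  subst hXu0
  have hXx0 : Xx ≠ 0 := by
    rintro rfl; simp at hX2
  have hc₂ : c₂ = 0 := by simpa [hXx0] using hX3
  have hUu0 : Uu ≠ 0 := by
    rintro rfl; simp [hc₂] at hU3
  have hsq0 := hsq 0 (by simpa using hXx0)
  refine ⟨hTt, rfl, hXx0, hUu0, by linear_combination hsq0, fun r => ?_⟩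
  obtain ⟨R, h1, h2⟩ := main 0 r (by simpa using hXx0)
  have hX2 : Xx ^ 2 ≠ 0 := pow_ne_zero 2 hXx0
  have hRX : Ux + r * Uu = Xx * R := by linear_combination h1
  rw [hRX]
  rw [← hsq0] at h2
  simp only [mul_zero, add_zero, zero_mul, zero_add, sub_zero] at h2
  have h3 := mul_left_cancel₀ hX2 (h2.trans (mul_assoc _ _ _))
  field_simp at h3
  linear_combination Xx * h3

end Pointwise

/-! ### Derivation of the determining equations -/

/-- The determining equations for admissible transformations `(T, X, U)` over `Ω`. -/
structure DeterminingEqs (Ω : Set (ℝ × ℝ × ℝ)) (T X U : ℝ × ℝ × ℝ → ℝ) : Prop where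
  T_x : ∀ p ∈ Ω, pd (0, 1, 0) T p = 0
  T_u : ∀ p ∈ Ω, pd (0, 0, 1) T p = 0
  T_t : ∀ p ∈ Ω, pd (1, 0, 0) T p ≠ 0
  X_u : ∀ p ∈ Ω, pd (0, 0, 1) X p = 0
  X_x : ∀ p ∈ Ω, pd (0, 1, 0) X p ≠ 0
  X_xx : ∀ p ∈ Ω, pd (0, 1, 0) (pd (0, 1, 0) X) p = 0
  U_xx : ∀ p ∈ Ω, pd (0, 1, 0) (pd (0, 1, 0) U) p = 0
  U_xu : ∀ p ∈ Ω, pd (0, 1, 0) (pd (0, 0, 1) U) p = 0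
  U_uu : ∀ p ∈ Ω, pd (0, 0, 1) (pd (0, 0, 1) U) p = 0
  U_t : ∀ p ∈ Ω, pd (1, 0, 0) U p = -(p.2.2 * pd (0, 1, 0) U p)
  U_eq : ∀ p ∈ Ω, pd (1, 0, 0) T p * U p = pd (1, 0, 0) X p + p.2.2 * pd (0, 1, 0) X p
  U_u : ∀ p ∈ Ω, pd (1, 0, 0) T p * pd (0, 0, 1) U p = pd (0, 1, 0) X p

theorem IsAdmissible.determiningEqs {L L' : BurgersEq} {Ω : Set (ℝ × ℝ × ℝ)}
    {Φ : ℝ × ℝ × ℝ → ℝ × ℝ × ℝ} (h : IsAdmissible L L' Ω Φ) :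
    DeterminingEqs Ω (fun p => (Φ p).1) (fun p => (Φ p).2.1) (fun p => (Φ p).2.2) ∧
      ∀ p ∈ Ω, pd (0, 1, 0) (fun p => (Φ p).2.1) p ^ 2 * L.coeff p.1 =
        pd (1, 0, 0) (fun p => (Φ p).1) p * L'.coeff (Φ p).1 := by
  have hΩ := h.isPointTransformation.isOpen
  have hΦ := h.isPointTransformation.contDiffOn
  have hΦ' : ∀ p ∈ Ω, ContDiffAt ℝ ∞ Φ p := fun p hp => hΦ.contDiffAt (hΩ.mem_nhds hp)
  have hdet := h.isPointTransformation.det_ne_zero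
  have hg : ∀ p ∈ Ω, L.coeff p.1 ≠ 0 := fun p hp => L.coeff_ne_zero _ (h.source p hp)
  have hg' : ∀ p ∈ Ω, L'.coeff (Φ p).1 ≠ 0 := fun p hp => L'.coeff_ne_zero _ (h.target p hp)
  have hgd : ∀ p ∈ Ω, DifferentiableAt ℝ L.coeff p.1 := fun p hp =>
    (L.contDiffOn_coeff.contDiffAt (L.isOpen_dom.mem_nhds (h.source p hp))).differentiableAt
      (by simp)
  have hgd' : ∀ p ∈ Ω, DifferentiableAt ℝ L'.coeff (Φ p).1 := fun p hp =>
    (L'.contDiffOn_coeff.contDiffAt (L'.isOpen_dom.mem_nhds (h.target p hp))).differentiableAt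
      (by simp)
  have T_x : ∀ p ∈ Ω, pd (0, 1, 0) (fun p => (Φ p).1) p = 0 := fun p hp =>
    (h.maps.time_stationary hp (hΦ' p hp) (hdet p hp) (hg p hp) (hg' p hp)).1
  have T_u : ∀ p ∈ Ω, pd (0, 0, 1) (fun p => (Φ p).1) p = 0 := fun p hp =>
    (h.maps.time_stationary hp (hΦ' p hp) (hdet p hp) (hg p hp) (hg' p hp)).2
  have key := fun p hp => h.maps.space_stationary hp (hΦ' p hp) (hdet p hp) (hg p hp) rfl rfl rfl
    (T_x p hp) (T_u p hp) (fun r => by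
      rw [fderiv_fderiv_spatial hΩ hΦ.fst hp, pd_of_eq_const hΩ T_x hp, pd_of_eq_const hΩ T_u hp,
        pd_of_eq_const hΩ T_u hp]; ring)
  have cT : ContDiffOn ℝ ∞ (fun p => (Φ p).1) Ω := hΦ.fst
  have cX : ContDiffOn ℝ ∞ (fun p => (Φ p).2.1) Ω := hΦ.snd.fst
  have cU : ContDiffOn ℝ ∞ (fun p => (Φ p).2.2) Ω := hΦ.snd.snd
  set T : ℝ × ℝ × ℝ → ℝ := fun p => (Φ p).1 with hT
  set X : ℝ × ℝ × ℝ → ℝ := fun p => (Φ p).2.1 with hX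
  set U : ℝ × ℝ × ℝ → ℝ := fun p => (Φ p).2.2 with hU
  have dif : ∀ f : ℝ × ℝ × ℝ → ℝ, ContDiffOn ℝ ∞ f Ω → ∀ p ∈ Ω, DifferentiableAt ℝ f p :=
    fun f hf p hp => hf.differentiableAt_of_isOpen hΩ hp
  have dif1 : ∀ f : ℝ × ℝ × ℝ → ℝ, ContDiffOn ℝ ∞ f Ω → ∀ e, ∀ p ∈ Ω,
      DifferentiableAt ℝ (pd e f) p := fun f hf e => dif _ (contDiffOn_pd hΩ hf)
  have T_t : ∀ p ∈ Ω, pd (1, 0, 0) T p ≠ 0 := fun p hp => (key p hp).1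
  have X_u : ∀ p ∈ Ω, pd (0, 0, 1) X p = 0 := fun p hp => (key p hp).2.1
  have X_x : ∀ p ∈ Ω, pd (0, 1, 0) X p ≠ 0 := fun p hp => (key p hp).2.2.1
  have U_u_ne : ∀ p ∈ Ω, pd (0, 0, 1) U p ≠ 0 := fun p hp => (key p hp).2.2.2.1
  have hsq : ∀ p ∈ Ω, pd (0, 1, 0) X p ^ 2 * L.coeff p.1 = pd (1, 0, 0) T p * L'.coeff (T p) :=
    fun p hp => (key p hp).2.2.2.2.1
  have T_te : ∀ e, (∀ p ∈ Ω, pd e T p = 0) → ∀ p ∈ Ω, pd e (pd (1, 0, 0) T) p = 0 := by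
    intro e he p hp
    rw [pd_comm hΩ cT hp, pd_of_eq_const hΩ he hp]
  -- Differentiate `hsq` in `x`: every factor except `X_x²` has zero `x`-derivative.
  have X_xx : ∀ p ∈ Ω, pd (0, 1, 0) (pd (0, 1, 0) X) p = 0 := by
    intro p hp
    have e1 := pd_congr (e := (0, 1, 0)) hΩ hsq hp
    have dXx := dif1 X cX (0, 1, 0) p hp
    have dc : DifferentiableAt ℝ (fun p : ℝ × ℝ × ℝ => L.coeff p.1) p :=
      (hgd p hp).comp p differentiableAt_fst
    have dc' : DifferentiableAt ℝ (fun p : ℝ × ℝ × ℝ => L'.coeff (T p)) p :=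
      DifferentiableAt.comp p (hgd' p hp) (dif T cT p hp)
    rw [pd_mul (dXx.fun_pow 2) dc, pd_mul (dif1 T cT _ p hp) dc', pd_comp (hgd p hp) differentiableAt_fst,
      pd_comp (f := T) (hgd' p hp) (dif T cT p hp), pd_time, T_x p hp, T_te _ T_x p hp] at e1
    have e2 : pd (0, 1, 0) (fun p => pd (0, 1, 0) X p ^ 2) p =
        2 * pd (0, 1, 0) X p * pd (0, 1, 0) (pd (0, 1, 0) X) p := by
      simp only [pow_two]
      rw [pd_mul dXx dXx]; ring
    have e3 : pd (0, 1, 0) (fun p => pd (0, 1, 0) X p ^ 2) p = 0 := by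
      simpa [hg p hp] using e1
    rw [e2] at e3
    simpa [X_x p hp] using e3
  have X_xu : ∀ p ∈ Ω, pd (0, 0, 1) (pd (0, 1, 0) X) p = 0 := by
    intro p hp
    rw [pd_comm hΩ cX hp, pd_of_eq_const hΩ X_u hp]
  have X_tu : ∀ p ∈ Ω, pd (0, 0, 1) (pd (1, 0, 0) X) p = 0 := by
    intro p hp
    rw [pd_comm hΩ cX hp, pd_of_eq_const hΩ X_u hp]
  -- An identity quadratic in `r`; its coefficients are read off below from the values at `0`, `1`,
  -- `-1`.
  have split : ∀ p ∈ Ω, ∀ r : ℝ, pd (0, 1, 0) X p * pd (1, 0, 0) U p +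
      (pd (1, 0, 0) T p * U p - pd (1, 0, 0) X p) * (pd (0, 1, 0) U p + r * pd (0, 0, 1) U p) =
      L.coeff p.1 * (pd (0, 1, 0) X p * (pd (0, 1, 0) (pd (0, 1, 0) U) p +
        2 * r * pd (0, 1, 0) (pd (0, 0, 1) U) p + r ^ 2 * pd (0, 0, 1) (pd (0, 0, 1) U) p)) +
      pd (0, 1, 0) X p * (p.2.2 * r * pd (0, 0, 1) U p) := by
    intro p hp r
    have e1 := (key p hp).2.2.2.2.2 r
    rw [fderiv_fderiv_spatial hΩ cU hp, fderiv_fderiv_spatial hΩ cX hp, X_xx p hp,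
      pd_of_eq_const hΩ X_u hp, pd_of_eq_const hΩ X_u hp] at e1
    simp only [mul_zero, add_zero, sub_zero] at e1
    exact e1
  have U_uu : ∀ p ∈ Ω, pd (0, 0, 1) (pd (0, 0, 1) U) p = 0 := by
    intro p hp
    have e0 := split p hp 0
    have e1 := split p hp 1
    have e2 := split p hp (-1)
    have e3 : L.coeff p.1 * pd (0, 1, 0) X p * pd (0, 0, 1) (pd (0, 0, 1) U) p = 0 := by
      linear_combination e0 - (e1 + e2) / 2
    simpa [hg p hp, X_x p hp] using e3
  have lin : ∀ p ∈ Ω, (pd (1, 0, 0) T p * U p - pd (1, 0, 0) X p) * pd (0, 0, 1) U p =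
      pd (0, 1, 0) X p * (L.coeff p.1 * (2 * pd (0, 1, 0) (pd (0, 0, 1) U) p) +
        p.2.2 * pd (0, 0, 1) U p) := by
    intro p hp
    have e1 := split p hp 1
    have e2 := split p hp (-1)
    linear_combination (e1 - e2) / 2
  -- The `u`-derivative of `lin`: the term with `U_xu` drops out because `U_uu = 0`, leaving `T_t
  -- U_u² = X_x U_u`.
  have U_u : ∀ p ∈ Ω, pd (1, 0, 0) T p * pd (0, 0, 1) U p = pd (0, 1, 0) X p := by
    intro p hp
    have dTt := dif1 T cT (1, 0, 0) p hp
    have dU := dif U cU p hp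
    have dXt := dif1 X cX (1, 0, 0) p hp
    have dXx := dif1 X cX (0, 1, 0) p hp
    have dUu := dif1 U cU (0, 0, 1) p hp
    have dUxu := dif1 _ (contDiffOn_pd hΩ cU (e := (0, 0, 1))) (0, 1, 0) p hp
    have dc : DifferentiableAt ℝ (fun p : ℝ × ℝ × ℝ => L.coeff p.1) p :=
      (hgd p hp).comp p differentiableAt_fst
    have du : DifferentiableAt ℝ (fun p : ℝ × ℝ × ℝ => p.2.2) p := by fun_prop
    have e1 := pd_congr (e := (0, 0, 1)) hΩ lin hp
    rw [pd_mul ((dTt.fun_mul dU).fun_sub dXt) dUu, pd_sub (dTt.fun_mul dU) dXt, pd_mul dTt dU, pd_mul dXx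
      ((dc.fun_mul (dUxu.const_mul 2)).fun_add (du.fun_mul dUu)), pd_add (dc.fun_mul (dUxu.const_mul 2))
      (du.fun_mul dUu), pd_mul dc (dUxu.const_mul 2), pd_mul (differentiableAt_const 2) dUxu,
      pd_mul du dUu, pd_comp (hgd p hp) differentiableAt_fst, pd_time, pd_value, pd_const,
      X_xu p hp, X_tu p hp, T_te _ T_u p hp, U_uu p hp,
      pd_comm hΩ (contDiffOn_pd hΩ cU) hp, pd_of_eq_const hΩ U_uu hp] at e1
    refine mul_left_cancel₀ (U_u_ne p hp) ?_
    linear_combination e1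
  have U_xu : ∀ p ∈ Ω, pd (0, 1, 0) (pd (0, 0, 1) U) p = 0 := by
    intro p hp
    have e1 := pd_congr (e := (0, 1, 0)) hΩ U_u hp
    rw [pd_mul (dif1 T cT _ p hp) (dif1 U cU _ p hp), X_xx p hp, T_te _ T_x p hp] at e1
    simpa [T_t p hp] using e1
  have U_eq : ∀ p ∈ Ω, pd (1, 0, 0) T p * U p = pd (1, 0, 0) X p + p.2.2 * pd (0, 1, 0) X p := by
    intro p hp
    have e1 := lin p hp
    rw [U_xu p hp] at e1
    have := mul_left_cancel₀ (U_u_ne p hp) (b := pd (1, 0, 0) T p * U p - pd (1, 0, 0) X p)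
      (c := p.2.2 * pd (0, 1, 0) X p) (by linear_combination e1)
    linear_combination this
  have U_x : ∀ p ∈ Ω, pd (1, 0, 0) T p * pd (0, 1, 0) U p = pd (1, 0, 0) (pd (0, 1, 0) X) p := by
    intro p hp
    have du : DifferentiableAt ℝ (fun p : ℝ × ℝ × ℝ => p.2.2) p := by fun_prop
    have dXx := dif1 X cX (0, 1, 0) p hp
    have e1 := pd_congr (e := (0, 1, 0)) hΩ U_eq hp
    rw [pd_mul (dif1 T cT _ p hp) (dif U cU p hp), pd_add (dif1 X cX _ p hp) (du.fun_mul dXx),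
      pd_mul du dXx, X_xx p hp, T_te _ T_x p hp, pd_value, pd_comm hΩ cX hp] at e1
    linear_combination e1
  have U_xx : ∀ p ∈ Ω, pd (0, 1, 0) (pd (0, 1, 0) U) p = 0 := by
    intro p hp
    have e1 := pd_congr (e := (0, 1, 0)) hΩ U_x hp
    rw [pd_mul (dif1 T cT _ p hp) (dif1 U cU _ p hp), T_te _ T_x p hp,
      pd_comm hΩ (contDiffOn_pd hΩ cX) hp, pd_of_eq_const hΩ X_xx hp] at e1
    simpa [T_t p hp] using e1
  have U_t : ∀ p ∈ Ω, pd (1, 0, 0) U p = -(p.2.2 * pd (0, 1, 0) U p) := by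
    intro p hp
    -- The coefficient of `r⁰`, where `U_eq` replaces `T_t U - X_t` by `u X_x`.
    have e1 := split p hp 0
    rw [U_xx p hp] at e1
    refine mul_left_cancel₀ (X_x p hp) ?_
    linear_combination e1 - pd (0, 1, 0) U p * U_eq p hp
  exact ⟨⟨T_x, T_u, T_t, X_u, X_x, X_xx, U_xx, U_xu, U_uu, U_t, U_eq, U_u⟩, hsq⟩

/-! ### Integration of the determining equations -/

/-- The first integrals are `U_x = k`, `U_u = n - kt`, `U = kx + (n - kt)u + j`, `X_x = kT + l`,
`X_x (n - kt) = C`, `T (n - kt) = lt + m` and `X = x X_x + jT + i`. The last conclusion, `(αδ - βγ)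
X_x² = T_t`, is what later turns the coefficient relation into a constant rescaling. -/
theorem DeterminingEqs.solve {Ω : Set (ℝ × ℝ × ℝ)} {T X U : ℝ × ℝ × ℝ → ℝ}
    (h : DeterminingEqs Ω T X U) (hΩ : IsOpen Ω) (hc : IsConnected Ω) (cT : ContDiffOn ℝ ∞ T Ω)
    (cX : ContDiffOn ℝ ∞ X Ω) (cU : ContDiffOn ℝ ∞ U Ω) :
    ∃ α β γ δ μ₀ μ₁ : ℝ, α * δ - β * γ ≠ 0 ∧ ∀ t x u : ℝ, (t, x, u) ∈ Ω →
      γ * t + δ ≠ 0 ∧ T (t, x, u) = (α * t + β) / (γ * t + δ) ∧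
      X (t, x, u) = (x + μ₁ * t + μ₀) / (γ * t + δ) ∧
      U (t, x, u) = ((γ * t + δ) * u - γ * x + μ₁ * δ - μ₀ * γ) / (α * δ - β * γ) ∧
      (α * δ - β * γ) * pd (0, 1, 0) X (t, x, u) ^ 2 = pd (1, 0, 0) T (t, x, u) := by
  have dif : ∀ f : ℝ × ℝ × ℝ → ℝ, ContDiffOn ℝ ∞ f Ω → ∀ p ∈ Ω, DifferentiableAt ℝ f p :=
    fun f hf p hp => hf.differentiableAt_of_isOpen hΩ hp
  have c1 : ∀ {f : ℝ × ℝ × ℝ → ℝ} {e}, ContDiffOn ℝ ∞ f Ω → ContDiffOn ℝ ∞ (pd e f) Ω :=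
    fun hf => contDiffOn_pd hΩ hf
  have ct : ContDiffOn ℝ ∞ (fun p : ℝ × ℝ × ℝ => p.1) Ω := contDiffOn_fst
  have cx : ContDiffOn ℝ ∞ (fun p : ℝ × ℝ × ℝ => p.2.1) Ω := contDiffOn_snd.fst
  have cu : ContDiffOn ℝ ∞ (fun p : ℝ × ℝ × ℝ => p.2.2) Ω := contDiffOn_snd.snd
  have cc : ∀ a : ℝ, ContDiffOn ℝ ∞ (fun _ : ℝ × ℝ × ℝ => a) Ω := fun a => contDiffOn_const
  have mul : ∀ {f f' : ℝ × ℝ × ℝ → ℝ}, ContDiffOn ℝ ∞ f Ω → ContDiffOn ℝ ∞ f' Ω → ∀ e, ∀ p ∈ Ω,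
      pd e (fun p => f p * f' p) p = f p * pd e f' p + f' p * pd e f p :=
    fun hf hf' e p hp => pd_mul (dif _ hf p hp) (dif _ hf' p hp)
  have sub : ∀ {f f' : ℝ × ℝ × ℝ → ℝ}, ContDiffOn ℝ ∞ f Ω → ContDiffOn ℝ ∞ f' Ω → ∀ e, ∀ p ∈ Ω,
      pd e (fun p => f p - f' p) p = pd e f p - pd e f' p :=
    fun hf hf' e p hp => pd_sub (dif _ hf p hp) (dif _ hf' p hp)
  have cmul : ∀ (a : ℝ) {f : ℝ × ℝ × ℝ → ℝ}, ContDiffOn ℝ ∞ f Ω → ∀ e, ∀ p ∈ Ω,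
      pd e (fun p => a * f p) p = a * pd e f p := by
    intro a f hf e p hp
    rw [mul (cc a) hf e p hp, pd_const]; ring
  have X_ux : ∀ p ∈ Ω, pd (0, 0, 1) (pd (0, 1, 0) X) p = 0 := fun p hp => by
    rw [pd_comm hΩ cX hp, pd_of_eq_const hΩ h.X_u hp]
  have neg : ∀ e, ∀ p ∈ Ω, pd e (fun p => -(p.2.2 * pd (0, 1, 0) U p)) p =
      -(p.2.2 * pd e (pd (0, 1, 0) U) p + pd (0, 1, 0) U p * e.2.2) := by
    intro e p hp
    have : (fun p : ℝ × ℝ × ℝ => -(p.2.2 * pd (0, 1, 0) U p)) =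
        fun p => (-1) * (p.2.2 * pd (0, 1, 0) U p) := by funext p; ring
    rw [this, cmul _ (cu.mul (c1 cU)) e p hp, mul cu (c1 cU) e p hp, pd_value]; ring
  obtain ⟨k, hk⟩ := exists_const_of_pd hΩ hc (c1 (e := (0, 1, 0)) cU)
    (fun p hp => by
      rw [pd_comm hΩ cU hp, pd_congr hΩ h.U_t hp, neg _ p hp, h.U_xx p hp]; ring)
    h.U_xx
    (fun p hp => by rw [pd_comm hΩ cU hp, h.U_xu p hp])
  have hk0 : ∀ e, ∀ p ∈ Ω, pd e (pd (0, 1, 0) U) p = 0 := fun e p hp => pd_of_eq_const hΩ hk hp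
  obtain ⟨n, hn⟩ := exists_const_of_pd hΩ hc
    (f := fun p => pd (0, 0, 1) U p - (-k) * p.1) ((c1 cU).sub ((cc _).mul ct))
    (fun p hp => by
      rw [sub (c1 cU) ((cc _).mul ct) _ p hp, cmul _ ct _ p hp, pd_comm hΩ cU hp,
        pd_congr hΩ h.U_t hp, neg _ p hp, hk0 _ p hp, hk p hp, pd_time]; ring)
    (fun p hp => by
      rw [sub (c1 cU) ((cc _).mul ct) _ p hp, cmul _ ct _ p hp, h.U_xu p hp, pd_time]; ring)
    (fun p hp => by
      rw [sub (c1 cU) ((cc _).mul ct) _ p hp, cmul _ ct _ p hp, h.U_uu p hp, pd_time]; ring)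
  have cn : ContDiffOn ℝ ∞ (fun p : ℝ × ℝ × ℝ => n - k * p.1) Ω := (cc n).sub ((cc k).mul ct)
  have pn : ∀ e, ∀ p ∈ Ω, pd e (fun p : ℝ × ℝ × ℝ => n - k * p.1) p = -(k * e.1) := by
    intro e p hp
    rw [sub (cc n) ((cc k).mul ct) e p hp, cmul _ ct e p hp, pd_const, pd_time]; ring
  have hUu : ∀ p ∈ Ω, pd (0, 0, 1) U p = n - k * p.1 := fun p hp => by linarith [hn p hp]
  obtain ⟨j, hj⟩ := exists_const_of_pd hΩ hc
    (f := fun p => U p - k * p.2.1 - (n - k * p.1) * p.2.2)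
    ((cU.sub ((cc _).mul cx)).sub (cn.mul cu))
    (fun p hp => by
      rw [sub (cU.sub ((cc _).mul cx)) (cn.mul cu) _ p hp, sub cU ((cc _).mul cx) _ p hp,
        cmul _ cx _ p hp, mul cn cu _ p hp, pn _ p hp, pd_space, pd_value, h.U_t p hp, hk p hp]
      ring)
    (fun p hp => by
      rw [sub (cU.sub ((cc _).mul cx)) (cn.mul cu) _ p hp, sub cU ((cc _).mul cx) _ p hp,
        cmul _ cx _ p hp, mul cn cu _ p hp, pn _ p hp, pd_space, pd_value, hk p hp]
      ring)
    (fun p hp => by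
      rw [sub (cU.sub ((cc _).mul cx)) (cn.mul cu) _ p hp, sub cU ((cc _).mul cx) _ p hp,
        cmul _ cx _ p hp, mul cn cu _ p hp, pn _ p hp, pd_space, pd_value, hUu p hp]
      ring)
  have hTX : ∀ p ∈ Ω, pd (1, 0, 0) T p * (n - k * p.1) = pd (0, 1, 0) X p := fun p hp => by
    rw [← hUu p hp, h.U_u p hp]
  have T_tx : ∀ p ∈ Ω, pd (0, 1, 0) (pd (1, 0, 0) T) p = 0 := fun p hp => by
    rw [pd_comm hΩ cT hp, pd_of_eq_const hΩ h.T_x hp]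
  have hXt : ∀ p ∈ Ω, pd (1, 0, 0) X p = pd (1, 0, 0) T p * U p - p.2.2 * pd (0, 1, 0) X p :=
    fun p hp => by linarith [h.U_eq p hp]
  have X_xt : ∀ p ∈ Ω, pd (1, 0, 0) (pd (0, 1, 0) X) p = k * pd (1, 0, 0) T p := by
    intro p hp
    rw [pd_comm hΩ cX hp, pd_congr hΩ hXt hp, sub ((c1 cT).mul cU) (cu.mul (c1 cX)) _ p hp,
      mul (c1 cT) cU _ p hp, mul cu (c1 cX) _ p hp, T_tx p hp, h.X_xx p hp, hk p hp, pd_value]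
    ring
  obtain ⟨l, hl⟩ := exists_const_of_pd hΩ hc (f := fun p => pd (0, 1, 0) X p - k * T p)
    ((c1 cX).sub ((cc _).mul cT))
    (fun p hp => by
      rw [sub (c1 cX) ((cc _).mul cT) _ p hp, cmul _ cT _ p hp, X_xt p hp]; ring)
    (fun p hp => by
      rw [sub (c1 cX) ((cc _).mul cT) _ p hp, cmul _ cT _ p hp, h.X_xx p hp, h.T_x p hp]; ring)
    (fun p hp => by
      rw [sub (c1 cX) ((cc _).mul cT) _ p hp, cmul _ cT _ p hp, X_ux p hp, h.T_u p hp]; ring)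
  obtain ⟨C, hC⟩ := exists_const_of_pd hΩ hc (f := fun p => pd (0, 1, 0) X p * (n - k * p.1))
    ((c1 cX).mul cn)
    (fun p hp => by
      rw [mul (c1 cX) cn _ p hp, pn _ p hp, X_xt p hp]
      linear_combination k * hTX p hp)
    (fun p hp => by rw [mul (c1 cX) cn _ p hp, pn _ p hp, h.X_xx p hp]; ring)
    (fun p hp => by rw [mul (c1 cX) cn _ p hp, pn _ p hp, X_ux p hp]; ring)
  obtain ⟨m, hm⟩ := exists_const_of_pd hΩ hc (f := fun p => T p * (n - k * p.1) - l * p.1)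
    ((cT.mul cn).sub ((cc _).mul ct))
    (fun p hp => by
      rw [sub (cT.mul cn) ((cc _).mul ct) _ p hp, mul cT cn _ p hp, cmul _ ct _ p hp, pn _ p hp,
        pd_time]
      linear_combination hTX p hp + hl p hp)
    (fun p hp => by
      rw [sub (cT.mul cn) ((cc _).mul ct) _ p hp, mul cT cn _ p hp, cmul _ ct _ p hp, pn _ p hp,
        pd_time, h.T_x p hp]; ring)
    (fun p hp => by
      rw [sub (cT.mul cn) ((cc _).mul ct) _ p hp, mul cT cn _ p hp, cmul _ ct _ p hp, pn _ p hp,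
        pd_time, h.T_u p hp]; ring)
  obtain ⟨i, hi⟩ := exists_const_of_pd hΩ hc (f := fun p => X p - pd (0, 1, 0) X p * p.2.1 - j * T p)
    ((cX.sub ((c1 cX).mul cx)).sub ((cc _).mul cT))
    (fun p hp => by
      rw [sub (cX.sub ((c1 cX).mul cx)) ((cc _).mul cT) _ p hp, sub cX ((c1 cX).mul cx) _ p hp,
        mul (c1 cX) cx _ p hp, cmul _ cT _ p hp, pd_space, X_xt p hp]
      linear_combination hXt p hp + pd (1, 0, 0) T p * hj p hp + p.2.2 * hTX p hp)
    (fun p hp => by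
      rw [sub (cX.sub ((c1 cX).mul cx)) ((cc _).mul cT) _ p hp, sub cX ((c1 cX).mul cx) _ p hp,
        mul (c1 cX) cx _ p hp, cmul _ cT _ p hp, pd_space, h.X_xx p hp, h.T_x p hp]
      ring)
    (fun p hp => by
      rw [sub (cX.sub ((c1 cX).mul cx)) ((cc _).mul cT) _ p hp, sub cX ((c1 cX).mul cx) _ p hp,
        mul (c1 cX) cx _ p hp, cmul _ cT _ p hp, pd_space, X_ux p hp, h.T_u p hp, h.X_u p hp]
      ring)
  have hn0 : ∀ p ∈ Ω, n - k * p.1 ≠ 0 := fun p hp h0 => h.X_x p hp (by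
    rw [← hTX p hp, h0, mul_zero])
  obtain ⟨q, hq⟩ := hc.nonempty
  have hC0 : C ≠ 0 := by
    rw [← hC q hq]; exact mul_ne_zero (h.X_x q hq) (hn0 q hq)
  -- Compatibility of the first integrals; up to scaling it is the determinant of the linear
  -- fractional map.
  have hlC : l * n + k * m = C := by
    linear_combination hC q hq - (n - k * q.1) * hl q hq - k * hm q hq
  have hΔ : l / C * (n / C) - m / C * (-k / C) = 1 / C := by
    rw [eq_div_iff hC0]; field_simp; linear_combination hlC
  -- Dividing by `C` normalizes the coefficient of `x` in the numerator of `X` to `1`, since `X_x =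
  -- C / (n - kt)`.
  refine ⟨l / C, m / C, -k / C, n / C, (j * m + i * n) / C, (j * l - i * k) / C, ?_, ?_⟩
  · rw [hΔ]; exact one_div_ne_zero hC0
  intro t x u hp
  have h0 : n - k * t ≠ 0 := hn0 _ hp
  have hγ : -k / C * t + n / C = (n - k * t) / C := by ring
  rw [hγ, hΔ]
  have e1 := hm _ hp
  have e2 := hC _ hp
  have e3 := hi _ hp
  have e4 := hj _ hp
  have e5 := hTX _ hp
  simp only at e1 e2 e3 e4 e5
  refine ⟨div_ne_zero h0 hC0, ?_, ?_, ?_, ?_⟩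
  · rw [eq_div_iff (div_ne_zero h0 hC0)]; field_simp; linear_combination e1
  · rw [eq_div_iff (div_ne_zero h0 hC0)]; field_simp
    linear_combination (n - k * t) * e3 + x * e2 + j * e1
  · field_simp
    linear_combination C * e4 - j * hlC
  · refine mul_right_cancel₀ h0 ?_
    rw [e5]; field_simp
    linear_combination pd (0, 1, 0) X (t, x, u) * e2

/-! ### The family maps Burgers equations to Burgers equations -/

/-- `Φ` is the given transformation on `Ω`. -/
def IsProjective (Ω : Set (ℝ × ℝ × ℝ)) (Φ : ℝ × ℝ × ℝ → ℝ × ℝ × ℝ) (α β γ δ μ₀ μ₁ : ℝ) : Prop :=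
  ∀ t x u : ℝ, (t, x, u) ∈ Ω → γ * t + δ ≠ 0 ∧
    Φ (t, x, u) = ((α * t + β) / (γ * t + δ), (x + μ₁ * t + μ₀) / (γ * t + δ),
      ((γ * t + δ) * u - γ * x + μ₁ * δ - μ₀ * γ) / (α * δ - β * γ))

theorem IsProjective.mapsBurgers {Ω : Set (ℝ × ℝ × ℝ)} {Φ : ℝ × ℝ × ℝ → ℝ × ℝ × ℝ}
    {α β γ δ μ₀ μ₁ : ℝ} {g g' : ℝ → ℝ} (hΦ : IsProjective Ω Φ α β γ δ μ₀ μ₁) (hΩ : IsOpen Ω)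
    (hΔ : α * δ - β * γ ≠ 0) (hg : ∀ p ∈ Ω, g' (Φ p).1 = g p.1 / (α * δ - β * γ)) :
    MapsBurgers Ω Φ g g' := by
  rintro v w ⟨t, x⟩ hq hv - hw heq
  have hD : γ * t + δ ≠ 0 := (hΦ t x _ hq).1
  have hgq := hg _ hq
  have hev : ∀ᶠ r in 𝓝 (t, x), w ((α * r.1 + β) / (γ * r.1 + δ),
      (r.2 + μ₁ * r.1 + μ₀) / (γ * r.1 + δ)) =
      ((γ * r.1 + δ) * v r - γ * r.2 + μ₁ * δ - μ₀ * γ) / (α * δ - β * γ) := by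
    have h1 : ∀ᶠ r in 𝓝 (t, x), graphPt v r ∈ Ω :=
      (contDiffAt_graphPt hv).continuousAt.eventually (hΩ.mem_nhds hq)
    filter_upwards [h1, heq] with r hr hr'
    have h2 := (hΦ _ _ _ hr).2
    rw [newIndep, newDep, graphPt, h2] at hr'
    exact hr'
  have hN : newIndep Φ v (t, x) = ((α * t + β) / (γ * t + δ),
      (x + μ₁ * t + μ₀) / (γ * t + δ)) := by
    rw [newIndep, graphPt, (hΦ _ _ _ hq).2]
  have hg1 : (Φ (graphPt v (t, x))).1 = (α * t + β) / (γ * t + δ) := by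
    rw [graphPt, (hΦ _ _ _ hq).2]
  rw [hg1] at hgq
  have hgp : (graphPt v (t, x)).1 = t := rfl
  rw [hgp] at hgq
  rw [hN] at hw ⊢
  clear hN hg1 hgp heq
  have hw0 := hev.self_of_nhds
  simp only at hw0
  unfold SatisfiesBurgersAt
  simp only
  rw [hgq, hw0, deriv_fst_eq (hw.differentiableAt (by simp))]
  -- the derivatives with respect to the space variable
  set f : ℝ → ℝ := fun y => v (t, y) with hf
  have hfc : ContDiffAt ℝ ∞ f x := by
    have : ContDiffAt ℝ ∞ (fun y : ℝ => (t, y)) x := contDiffAt_const.prodMk contDiffAt_id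
    exact ContDiffAt.comp (f := fun y : ℝ => (t, y)) x hv this
  set y₀ := (x + μ₁ * t + μ₀) / (γ * t + δ) with hy₀
  -- The inverse of `x ↦ X` at fixed time. It is affine, so `w` is explicit along the line of
  -- constant new time and its space derivatives can be computed directly.
  set m : ℝ → ℝ := fun y => (γ * t + δ) * y - (μ₁ * t + μ₀) with hm
  have hm0 : m y₀ = x := by simp only [hm, hy₀]; field_simp; ring
  have hmd : ∀ y, HasDerivAt m (γ * t + δ) y := fun y => by
    have := ((hasDerivAt_id y).const_mul (γ * t + δ)).sub_const (μ₁ * t + μ₀)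
    rwa [mul_one] at this
  have hmt : Filter.Tendsto m (𝓝 y₀) (𝓝 x) := by
    have := (hmd y₀).continuousAt.tendsto
    rwa [hm0] at this
  have hline : (fun y => w ((α * t + β) / (γ * t + δ), y)) =ᶠ[𝓝 y₀] fun y =>
      ((γ * t + δ) * f (m y) - γ * m y + μ₁ * δ - μ₀ * γ) / (α * δ - β * γ) := by
    have h1 : Filter.Tendsto (fun y => (t, m y)) (𝓝 y₀) (𝓝 (t, x)) :=
      tendsto_const_nhds.prodMk_nhds hmt
    filter_upwards [h1.eventually hev] with y hy
    have h2 : (m y + μ₁ * t + μ₀) / (γ * t + δ) = y := by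
      simp only [hm]; field_simp; ring
    rw [h2] at hy
    exact hy
  have hline1 : deriv (fun y => w ((α * t + β) / (γ * t + δ), y)) =ᶠ[𝓝 y₀] fun y =>
      ((γ * t + δ) * (deriv f (m y) * (γ * t + δ)) - γ * (γ * t + δ)) / (α * δ - β * γ) := by
    refine hline.deriv.trans ?_
    filter_upwards [hmt.eventually hfc.eventually_differentiableAt] with y hy
    have h1 : HasDerivAt (fun y => f (m y)) (deriv f (m y) * (γ * t + δ)) y :=
      hy.hasDerivAt.comp y (hmd y)
    exact (((((h1.const_mul (γ * t + δ)).sub ((hmd y).const_mul γ)).add_const (μ₁ * δ)).sub_const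
      (μ₀ * γ)).div_const (α * δ - β * γ)).deriv
  have hline2 : deriv (deriv fun y => w ((α * t + β) / (γ * t + δ), y)) y₀ =
      ((γ * t + δ) * (deriv (deriv f) x * (γ * t + δ) * (γ * t + δ))) / (α * δ - β * γ) := by
    rw [hline1.deriv_eq]
    have h0 : HasDerivAt (deriv f) (deriv (deriv f) x) (m y₀) := by
      rw [hm0]; exact hfc.differentiableAt_deriv.hasDerivAt
    have h1 : HasDerivAt (fun y => deriv f (m y)) (deriv (deriv f) x * (γ * t + δ)) y₀ :=
      h0.comp y₀ (hmd y₀)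
    exact ((((h1.mul_const (γ * t + δ)).const_mul (γ * t + δ)).sub_const
      (γ * (γ * t + δ))).div_const (α * δ - β * γ)).deriv
  have hwx := hline1.self_of_nhds
  simp only [hm0] at hwx
  -- the derivative with respect to the time variable
  have hden : HasDerivAt (fun s => γ * s + δ) γ t := by
    simpa using ((hasDerivAt_id t).const_mul γ).add_const δ
  have hTd : HasDerivAt (fun s => (α * s + β) / (γ * s + δ))
      ((α * (γ * t + δ) - (α * t + β) * γ) / (γ * t + δ) ^ 2) t := by
    have : HasDerivAt (fun s => α * s + β) α t := by
      simpa using ((hasDerivAt_id t).const_mul α).add_const β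
    exact this.div hden hD
  have hXd : HasDerivAt (fun s => (x + μ₁ * s + μ₀) / (γ * s + δ))
      ((μ₁ * (γ * t + δ) - (x + μ₁ * t + μ₀) * γ) / (γ * t + δ) ^ 2) t := by
    have : HasDerivAt (fun s => x + μ₁ * s + μ₀) μ₁ t := by
      simpa using (((hasDerivAt_id t).const_mul μ₁).const_add x).add_const μ₀
    exact this.div hden hD
  have hvd : HasDerivAt (fun s => v (s, x)) (deriv (fun s => v (s, x)) t) t := by
    have h1 : DifferentiableAt ℝ (fun s : ℝ => (s, x)) t := by fun_prop
    exact (DifferentiableAt.comp (f := fun s : ℝ => (s, x)) t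
      (hv.differentiableAt (by simp)) h1).hasDerivAt
  have hUd := ((((hden.mul hvd).sub_const (γ * x)).add_const (μ₁ * δ)).sub_const
    (μ₀ * γ)).div_const (α * δ - β * γ)
  -- The time derivative of `w` is found implicitly: differentiating along the image of the line of
  -- fixed `x` gives a combination of it with the known space derivative.
  have hWd : HasDerivAt (fun s => w ((α * s + β) / (γ * s + δ), (x + μ₁ * s + μ₀) / (γ * s + δ)))
      _ t := HasFDerivAt.comp_hasDerivAt
        (f := fun s => ((α * s + β) / (γ * s + δ), (x + μ₁ * s + μ₀) / (γ * s + δ))) t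
        (hw.differentiableAt (by simp)).hasFDerivAt (hTd.prodMk hXd)
  have hpull : (fun s => w ((α * s + β) / (γ * s + δ), (x + μ₁ * s + μ₀) / (γ * s + δ))) =ᶠ[𝓝 t]
      fun s => ((γ * s + δ) * v (s, x) - γ * x + μ₁ * δ - μ₀ * γ) / (α * δ - β * γ) := by
    have h1 : Filter.Tendsto (fun s => (s, x)) (𝓝 t) (𝓝 (t, x)) :=
      Filter.tendsto_id.prodMk_nhds tendsto_const_nhds
    exact h1.eventually hev
  have htime := hWd.unique (hUd.congr_of_eventuallyEq hpull)
  have hwx' := deriv_snd_eq (hw.differentiableAt (by simp))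
  simp only at hwx'
  rw [clm_apply_prod, ← hwx', hwx] at htime
  rw [hline2, hwx]
  generalize fderiv ℝ w ((α * t + β) / (γ * t + δ), y₀) (1, 0) = wt at *
  generalize deriv (fun s => v (s, x)) t = vt at *
  generalize deriv (deriv f) x = vxx at *
  generalize deriv f x = vx at *
  generalize v (t, x) = v₀ at *
  clear_value y₀
  have hwt : wt = ((γ * t + δ) ^ 2 * (γ * v₀ + (γ * t + δ) * vt) -
      (μ₁ * (γ * t + δ) - (x + μ₁ * t + μ₀) * γ) * ((γ * t + δ) * (vx * (γ * t + δ)) -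
        γ * (γ * t + δ))) / (α * δ - β * γ) ^ 2 := by
    rw [eq_div_iff (pow_ne_zero 2 hΔ)]
    have : α * (γ * t + δ) - (α * t + β) * γ = α * δ - β * γ := by ring
    rw [this] at htime
    field_simp at htime
    linear_combination htime
  -- The Burgers expression is only multiplied by a nonvanishing factor, which gives both directions
  -- of the equivalence.
  have hkey : wt + ((γ * t + δ) * v₀ - γ * x + μ₁ * δ - μ₀ * γ) / (α * δ - β * γ) *
      (((γ * t + δ) * (vx * (γ * t + δ)) - γ * (γ * t + δ)) / (α * δ - β * γ)) -
      g t / (α * δ - β * γ) *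
        ((γ * t + δ) * (vxx * (γ * t + δ) * (γ * t + δ)) / (α * δ - β * γ)) =
      (γ * t + δ) ^ 3 / (α * δ - β * γ) ^ 2 * (vt + v₀ * vx - g t * vxx) := by
    rw [hwt]; field_simp; ring
  have hne : (γ * t + δ) ^ 3 / (α * δ - β * γ) ^ 2 ≠ 0 :=
    div_ne_zero (pow_ne_zero 3 hD) (pow_ne_zero 2 hΔ)
  rw [← sub_eq_zero, ← sub_eq_zero (b := _ / _ * (_ / _)), hkey, mul_eq_zero, or_iff_right hne]

/-! ### Classification of admissible transformations -/

theorem IsAdmissible.isProjective {L L' : BurgersEq} {Ω : Set (ℝ × ℝ × ℝ)}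
    {Φ : ℝ × ℝ × ℝ → ℝ × ℝ × ℝ} (h : IsAdmissible L L' Ω Φ) :
    ∃ α β γ δ μ₀ μ₁ : ℝ, α * δ - β * γ ≠ 0 ∧ IsProjective Ω Φ α β γ δ μ₀ μ₁ ∧
      ∀ p ∈ Ω, (α * δ - β * γ) * pd (0, 1, 0) (fun p => (Φ p).2.1) p ^ 2 =
        pd (1, 0, 0) (fun p => (Φ p).1) p := by
  have hΩ := h.isPointTransformation
  have hΦ := hΩ.contDiffOn
  obtain ⟨α, β, γ, δ, μ₀, μ₁, hΔ, hs⟩ := h.determiningEqs.1.solve hΩ.isOpen hΩ.isConnected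
    hΦ.fst hΦ.snd.fst hΦ.snd.snd
  refine ⟨α, β, γ, δ, μ₀, μ₁, hΔ, fun t x u hp => ?_, fun p hp => (hs p.1 p.2.1 p.2.2 hp).2.2.2.2⟩
  obtain ⟨h1, h2, h3, h4, -⟩ := hs t x u hp
  exact ⟨h1, Prod.ext h2 (Prod.ext h3 h4)⟩

theorem IsAdmissible.coeff_eq {L L' : BurgersEq} {Ω : Set (ℝ × ℝ × ℝ)}
    {Φ : ℝ × ℝ × ℝ → ℝ × ℝ × ℝ} (h : IsAdmissible L L' Ω Φ) {Δ : ℝ} (hΔ : Δ ≠ 0)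
    (hs : ∀ p ∈ Ω, Δ * pd (0, 1, 0) (fun p => (Φ p).2.1) p ^ 2 =
      pd (1, 0, 0) (fun p => (Φ p).1) p) {p : ℝ × ℝ × ℝ} (hp : p ∈ Ω) :
    L'.coeff (Φ p).1 = L.coeff p.1 / Δ := by
  have h1 := h.determiningEqs.2 p hp
  rw [← hs p hp] at h1
  rw [eq_div_iff hΔ]
  refine mul_left_cancel₀ (pow_ne_zero 2 (h.determiningEqs.1.X_x p hp)) ?_
  linear_combination -h1

/-- The equation `u_t + u u_x = a u_xx`, for all times. -/
def constBurgers (a : ℝ) (ha : a ≠ 0) : BurgersEq where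
  dom := Set.univ
  coeff := fun _ => a
  isOpen_dom := isOpen_univ
  isConnected_dom := isConnected_univ
  contDiffOn_coeff := contDiffOn_const
  coeff_ne_zero := fun _ _ => ha

/-! ### Every usual equivalence belongs to the family -/

section UsualEquivalence

variable {Ω : Set (ℝ × ℝ × ℝ)} {Ψ : (ℝ × ℝ × ℝ) × ℝ → (ℝ × ℝ × ℝ) × ℝ}

/-- Projectability makes the Jacobian matrix of `Ψ` block triangular, so surjectivity of the full
derivative passes to the `(t, x, u)`-block. -/
theorem IsUsualEquivalence.isPointTransformation (h : IsUsualEquivalence Ω Ψ) {a : ℝ}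
    (ha : a ≠ 0) : IsPointTransformation Ω fun p => (Ψ (p, a)).1 := by
  have hΩa : IsOpen (Ω ×ˢ {a : ℝ | a ≠ 0}) := h.isOpen.prod isOpen_ne
  have hc : ContDiffOn ℝ ∞ (fun p => (Ψ (p, a)).1) Ω :=
    (h.contDiffOn.comp (contDiffOn_id.prodMk contDiffOn_const) (fun p hp => ⟨hp, ha⟩)).fst
  refine ⟨h.isOpen, h.isConnected, hc, fun p hp => ?_⟩
  have hpa : (p, a) ∈ Ω ×ˢ {a : ℝ | a ≠ 0} := ⟨hp, ha⟩
  have hd : DifferentiableAt ℝ Ψ (p, a) :=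
    (h.contDiffOn.contDiffAt (hΩa.mem_nhds hpa)).differentiableAt (by simp)
  have hd' : DifferentiableAt ℝ (fun p => (Ψ (p, a)).1) p :=
    (hc.contDiffAt (h.isOpen.mem_nhds hp)).differentiableAt (by simp)
  have e1 : HasFDerivAt (fun z => (Ψ z).1)
      ((ContinuousLinearMap.fst ℝ (ℝ × ℝ × ℝ) ℝ).comp (fderiv ℝ Ψ (p, a))) (p, a) :=
    hasFDerivAt_fst.comp (p, a) hd.hasFDerivAt
  have e2 : HasFDerivAt (fun z : (ℝ × ℝ × ℝ) × ℝ => (Ψ (z.1, a)).1)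
      ((fderiv ℝ (fun p => (Ψ (p, a)).1) p).comp (ContinuousLinearMap.fst ℝ (ℝ × ℝ × ℝ) ℝ))
      (p, a) :=
    HasFDerivAt.comp (g := fun p => (Ψ (p, a)).1) (f := Prod.fst) (p, a) hd'.hasFDerivAt
      hasFDerivAt_fst
  have e3 : (fun z => (Ψ z).1) =ᶠ[𝓝 (p, a)] fun z => (Ψ (z.1, a)).1 := by
    filter_upwards [hΩa.mem_nhds hpa] with z hz
    exact h.projectable z.1 hz.1 z.2 a hz.2 ha
  have e4 := e1.unique (e2.congr_of_eventuallyEq e3)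
  apply det_ne_zero_of_injective
  have hsurj : Function.Surjective (fderiv ℝ (fun p => (Ψ (p, a)).1) p) := by
    intro y
    obtain ⟨z, hz⟩ := surjective_of_det_ne_zero (h.det_ne_zero p hp a ha) (y, 0)
    refine ⟨z.1, ?_⟩
    have := congrArg (fun l => l z) e4
    simp only [ContinuousLinearMap.comp_apply, ContinuousLinearMap.coe_fst', hz] at this
    exact this.symm
  have hinj := LinearMap.injective_iff_surjective
    (f := (fderiv ℝ (fun p => (Ψ (p, a)).1) p : ℝ × ℝ × ℝ →ₗ[ℝ] ℝ × ℝ × ℝ)) |>.2 hsurj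
  intro z hz
  exact hinj (hz.trans (map_zero _).symm)

theorem IsUsualEquivalence.exists_isAdmissible (h : IsUsualEquivalence Ω Ψ) {a : ℝ}
    (ha : a ≠ 0) : ∃ L' : BurgersEq,
      IsAdmissible (constBurgers a ha) L' Ω (fun p => (Ψ (p, a)).1) ∧
      ∀ p ∈ Ω, L'.coeff (Ψ (p, a)).1.1 = (Ψ (p, a)).2 := by
  obtain ⟨L', h1, h2⟩ := h.maps (constBurgers a ha)
  have hset : {p ∈ Ω | p.1 ∈ (constBurgers a ha).dom} = Ω := by
    ext p; simp [constBurgers]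
  rw [hset] at h2
  exact ⟨L', ⟨h.isPointTransformation ha, fun _ _ => trivial, fun p hp => (h1 p hp trivial).1, h2⟩,
    fun p hp => (h1 p hp trivial).2⟩

/-- The constant coefficient `1` determines the parameters. Any other value `g` is reached by the
constant equation with that coefficient, and projectability guarantees the same `(t, x,
u)`-components, hence the same determinant in the scaling of `g`. -/
theorem IsUsualEquivalence.exists_parameters (h : IsUsualEquivalence Ω Ψ) :
    ∃ α β γ δ μ₀ μ₁ : ℝ, α * δ - β * γ ≠ 0 ∧ ∀ t x u : ℝ, (t, x, u) ∈ Ω → γ * t + δ ≠ 0 ∧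
      ∀ g : ℝ, g ≠ 0 → Ψ ((t, x, u), g) =
        (((α * t + β) / (γ * t + δ), (x + μ₁ * t + μ₀) / (γ * t + δ),
          ((γ * t + δ) * u - γ * x + μ₁ * δ - μ₀ * γ) / (α * δ - β * γ)),
          g / (α * δ - β * γ)) := by
  obtain ⟨L₁, hL₁, -⟩ := h.exists_isAdmissible one_ne_zero
  obtain ⟨α, β, γ, δ, μ₀, μ₁, hΔ, hpr, hs⟩ := hL₁.isProjective
  refine ⟨α, β, γ, δ, μ₀, μ₁, hΔ, fun t x u hp => ⟨(hpr t x u hp).1, fun g hg => ?_⟩⟩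
  obtain ⟨L', hL', hcoeff⟩ := h.exists_isAdmissible hg
  have hsg : ∀ p ∈ Ω, (α * δ - β * γ) * pd (0, 1, 0) (fun p => (Ψ (p, g)).1.2.1) p ^ 2 =
      pd (1, 0, 0) (fun p => (Ψ (p, g)).1.1) p := by
    intro p hp
    rw [pd_congr (f := fun p => (Ψ (p, g)).1.2.1) (f' := fun p => (Ψ (p, 1)).1.2.1) h.isOpen
      (fun p hp => by rw [h.projectable p hp g 1 hg one_ne_zero]) hp,
      pd_congr (f := fun p => (Ψ (p, g)).1.1) (f' := fun p => (Ψ (p, 1)).1.1) h.isOpen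
      (fun p hp => by rw [h.projectable p hp g 1 hg one_ne_zero]) hp]
    exact hs p hp
  refine Prod.ext ?_ ?_
  · rw [h.projectable _ hp g 1 hg one_ne_zero]
    exact (hpr t x u hp).2
  · rw [← hcoeff _ hp]
    exact hL'.coeff_eq hΔ hsg hp

end UsualEquivalence

/-! ### Every member of the family is a usual equivalence -/

section Converse

variable {Ω : Set (ℝ × ℝ × ℝ)} {Ψ : (ℝ × ℝ × ℝ) × ℝ → (ℝ × ℝ × ℝ) × ℝ} {α β γ δ μ₀ μ₁ : ℝ}

/-- The derivative is triangular: along a line in a kernel direction, the components `T`, `X`, `U`,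
`g` successively force `h₁`, `h₂`, `h₃`, `h₄` to vanish. -/
theorem projective_det_ne_zero {a t x u : ℝ} (hΔ : α * δ - β * γ ≠ 0) (hD : γ * t + δ ≠ 0)
    (hd : DifferentiableAt ℝ Ψ ((t, x, u), a))
    (heq : ∀ᶠ z in 𝓝 ((t, x, u), a), Ψ z =
      (((α * z.1.1 + β) / (γ * z.1.1 + δ), (z.1.2.1 + μ₁ * z.1.1 + μ₀) / (γ * z.1.1 + δ),
        ((γ * z.1.1 + δ) * z.1.2.2 - γ * z.1.2.1 + μ₁ * δ - μ₀ * γ) / (α * δ - β * γ)),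
        z.2 / (α * δ - β * γ))) :
    (fderiv ℝ Ψ ((t, x, u), a)).det ≠ 0 := by
  apply det_ne_zero_of_injective
  rintro ⟨⟨h₁, h₂, h₃⟩, h₄⟩ hh
  have aff : ∀ b h : ℝ, HasDerivAt (fun s : ℝ => b + s * h) h 0 := fun b h => by
    have := ((hasDerivAt_id (0 : ℝ)).mul_const h).const_add b
    rwa [one_mul] at this
  have hline : HasDerivAt (fun s : ℝ => ((t + s * h₁, x + s * h₂, u + s * h₃), a + s * h₄))
      ((h₁, h₂, h₃), h₄) 0 :=
    ((aff t h₁).prodMk ((aff x h₂).prodMk (aff u h₃))).prodMk (aff a h₄)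
  have hl0 : (fun s : ℝ => ((t + s * h₁, x + s * h₂, u + s * h₃), a + s * h₄)) 0 =
      ((t, x, u), a) := by simp
  have h0 : HasDerivAt (fun s : ℝ => Ψ ((t + s * h₁, x + s * h₂, u + s * h₃), a + s * h₄)) 0 0 := by
    rw [← hh]
    rw [← hl0] at hd
    have := hd.hasFDerivAt.comp_hasDerivAt 0 hline
    rw [hl0] at this
    exact this
  have hev := hline.continuousAt.tendsto
  simp only [zero_mul, add_zero] at hev
  have hev := hev.eventually heq
  have p1 : HasDerivAt (fun s : ℝ => (α * (t + s * h₁) + β) / (γ * (t + s * h₁) + δ)) 0 0 := by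
    have := hasFDerivAt_fst (𝕜 := ℝ) (E := ℝ) (F := ℝ × ℝ) |>.comp_hasDerivAt 0
      (hasFDerivAt_fst (𝕜 := ℝ) (E := ℝ × ℝ × ℝ) (F := ℝ) |>.comp_hasDerivAt 0 h0)
    refine HasDerivAt.congr_of_eventuallyEq (by simpa using this) ?_
    filter_upwards [hev] with s hs
    simp [hs]
  have p2 : HasDerivAt (fun s : ℝ => (x + s * h₂ + μ₁ * (t + s * h₁) + μ₀) /
      (γ * (t + s * h₁) + δ)) 0 0 := by
    have := hasFDerivAt_fst (𝕜 := ℝ) (E := ℝ) (F := ℝ) |>.comp_hasDerivAt 0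
      (hasFDerivAt_snd (𝕜 := ℝ) (E := ℝ) (F := ℝ × ℝ) |>.comp_hasDerivAt 0
      (hasFDerivAt_fst (𝕜 := ℝ) (E := ℝ × ℝ × ℝ) (F := ℝ) |>.comp_hasDerivAt 0 h0))
    refine HasDerivAt.congr_of_eventuallyEq (by simpa using this) ?_
    filter_upwards [hev] with s hs
    simp [hs]
  have p3 : HasDerivAt (fun s : ℝ => ((γ * (t + s * h₁) + δ) * (u + s * h₃) - γ * (x + s * h₂) +
      μ₁ * δ - μ₀ * γ) / (α * δ - β * γ)) 0 0 := by
    have := hasFDerivAt_snd (𝕜 := ℝ) (E := ℝ) (F := ℝ) |>.comp_hasDerivAt 0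
      (hasFDerivAt_snd (𝕜 := ℝ) (E := ℝ) (F := ℝ × ℝ) |>.comp_hasDerivAt 0
      (hasFDerivAt_fst (𝕜 := ℝ) (E := ℝ × ℝ × ℝ) (F := ℝ) |>.comp_hasDerivAt 0 h0))
    refine HasDerivAt.congr_of_eventuallyEq (by simpa using this) ?_
    filter_upwards [hev] with s hs
    simp [hs]
  have p4 : HasDerivAt (fun s : ℝ => (a + s * h₄) / (α * δ - β * γ)) 0 0 := by
    have := hasFDerivAt_snd (𝕜 := ℝ) (E := ℝ × ℝ × ℝ) (F := ℝ) |>.comp_hasDerivAt 0 h0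
    refine HasDerivAt.congr_of_eventuallyEq (by simpa using this) ?_
    filter_upwards [hev] with s hs
    simp [hs]
  have hD' : γ * (t + 0 * h₁) + δ ≠ 0 := by simpa using hD
  have q1 := p1.unique ((((aff t h₁).const_mul α).add_const β).div
    (((aff t h₁).const_mul γ).add_const δ) hD')
  have e1 : h₁ = 0 := by
    have := (div_eq_zero_iff.1 q1.symm).resolve_right (pow_ne_zero 2 hD')
    refine (mul_eq_zero.1 ?_).resolve_left hΔ
    linear_combination this
  subst e1
  simp only [mul_zero, add_zero] at p2 p3
  have q2 := p2.unique ((((aff x h₂).add_const (μ₁ * t)).add_const μ₀).div_const (γ * t + δ))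
  have e2 : h₂ = 0 := (div_eq_zero_iff.1 q2.symm).resolve_right hD
  subst e2
  simp only [mul_zero, add_zero] at p3
  have q3 := p3.unique ((((((aff u h₃).const_mul (γ * t + δ)).sub_const (γ * x)).add_const
    (μ₁ * δ)).sub_const (μ₀ * γ)).div_const (α * δ - β * γ))
  have e3 : h₃ = 0 :=
    (mul_eq_zero.1 ((div_eq_zero_iff.1 q3.symm).resolve_right hΔ)).resolve_left hD
  have q4 := p4.unique ((aff a h₄).div_const (α * δ - β * γ))
  have e4 : h₄ = 0 := (div_eq_zero_iff.1 q4.symm).resolve_right hΔ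
  rw [e3, e4]; rfl

/-- The image of an equation of the class under a linear fractional change of time. -/
theorem exists_image_equation (L : BurgersEq) (hΔ : α * δ - β * γ ≠ 0) {J : Set ℝ}
    (hJo : IsOpen J) (hJc : IsPreconnected J) (hJ : ∀ t ∈ J, γ * t + δ ≠ 0) :
    ∃ L' : BurgersEq, ∀ t ∈ J ∩ L.dom, (α * t + β) / (γ * t + δ) ∈ L'.dom ∧
      L'.coeff ((α * t + β) / (γ * t + δ)) = L.coeff t / (α * δ - β * γ) := by
  -- If no time of `J` lies in the domain, nothing is required and any equation serves. Otherwise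
  -- the new domain is the image of `J ∩ L.dom`, since `L.dom` itself may contain the pole.
  rcases (J ∩ L.dom).eq_empty_or_nonempty with hemp | hne
  · exact ⟨L, fun t ht => by rw [hemp] at ht; exact ht.elim⟩
  set T : ℝ → ℝ := fun t => (α * t + β) / (γ * t + δ) with hT
  set S : ℝ → ℝ := fun s => (δ * s - β) / (α - γ * s) with hS
  have hden : ∀ t, γ * t + δ ≠ 0 → α - γ * T t = (α * δ - β * γ) / (γ * t + δ) := by
    intro t ht; simp only [hT]; field_simp; ring
  have hden0 : ∀ t, γ * t + δ ≠ 0 → α - γ * T t ≠ 0 := fun t ht => by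
    rw [hden t ht]; exact div_ne_zero hΔ ht
  have hST : ∀ t, γ * t + δ ≠ 0 → S (T t) = t := by
    intro t ht
    rw [show S (T t) = (δ * T t - β) / (α - γ * T t) from rfl, div_eq_iff (hden0 t ht), hden t ht,
      mul_div_assoc' t, eq_div_iff ht]
    have hx : T t * (γ * t + δ) = α * t + β := div_mul_cancel₀ _ ht
    linear_combination δ * hx
  have hTS : ∀ s, α - γ * s ≠ 0 → T (S s) = s := by
    intro s hs
    have h1 : γ * S s + δ = (α * δ - β * γ) / (α - γ * s) := by
      simp only [hS]; field_simp; ring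
    rw [show T (S s) = (α * S s + β) / (γ * S s + δ) from rfl, h1,
      div_eq_iff (div_ne_zero hΔ hs), mul_div_assoc' s, eq_div_iff hs]
    have hx : S s * (α - γ * s) = δ * s - β := div_mul_cancel₀ _ hs
    linear_combination α * hx
  have hSc : ContDiffOn ℝ ∞ S {s | α - γ * s ≠ 0} :=
    ContDiffOn.div (by fun_prop) (by fun_prop) (fun s hs => hs)
  have hopen : IsOpen {s : ℝ | α - γ * s ≠ 0} :=
    isOpen_ne.preimage (f := fun s : ℝ => α - γ * s) (by fun_prop)
  have hTc : ContinuousOn T (J ∩ L.dom) :=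
    ContinuousOn.div (by fun_prop) (by fun_prop) (fun t ht => hJ t ht.1)
  have himage : T '' (J ∩ L.dom) = {s | α - γ * s ≠ 0} ∩ S ⁻¹' (J ∩ L.dom) := by
    ext s
    constructor
    · rintro ⟨t, ht, rfl⟩
      exact ⟨hden0 t (hJ t ht.1), by rw [Set.mem_preimage, hST t (hJ t ht.1)]; exact ht⟩
    · rintro ⟨hs, hs'⟩
      exact ⟨S s, hs', hTS s hs⟩
  -- On the real line connectedness is order-convexity, which is stable under intersection.
  have hconn : IsConnected (J ∩ L.dom) :=
    ⟨hne, (hJc.ordConnected.inter L.isConnected_dom.isPreconnected.ordConnected).isPreconnected⟩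
  refine ⟨⟨T '' (J ∩ L.dom), fun s => L.coeff (S s) / (α * δ - β * γ), ?_, hconn.image T hTc, ?_,
    ?_⟩, fun t ht => ⟨⟨t, ht, rfl⟩, ?_⟩⟩
  · rw [himage]
    exact hSc.continuousOn.isOpen_inter_preimage hopen (hJo.inter L.isOpen_dom)
  · rw [himage]
    exact (L.contDiffOn_coeff.comp (hSc.mono Set.inter_subset_left)
      (fun s hs => hs.2.2)).div_const _
  · rintro s ⟨t, ht, rfl⟩
    rw [hST t (hJ t ht.1)]
    exact div_ne_zero (L.coeff_ne_zero t ht.2) hΔ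
  · change L.coeff (S (T t)) / _ = _
    rw [hST t (hJ t ht.1)]

theorem isUsualEquivalence_of_parameters (hΩ : IsOpen Ω) (hc : IsConnected Ω)
    (hΔ : α * δ - β * γ ≠ 0)
    (h : ∀ t x u : ℝ, (t, x, u) ∈ Ω → γ * t + δ ≠ 0 ∧ ∀ g : ℝ, g ≠ 0 → Ψ ((t, x, u), g) =
        (((α * t + β) / (γ * t + δ), (x + μ₁ * t + μ₀) / (γ * t + δ),
          ((γ * t + δ) * u - γ * x + μ₁ * δ - μ₀ * γ) / (α * δ - β * γ)),
          g / (α * δ - β * γ))) :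
    IsUsualEquivalence Ω Ψ := by
  have hΩa : IsOpen (Ω ×ˢ {a : ℝ | a ≠ 0}) := hΩ.prod isOpen_ne
  have hcd : ContDiffOn ℝ ∞ Ψ (Ω ×ˢ {a : ℝ | a ≠ 0}) := by
    have hne : ∀ z ∈ Ω ×ˢ {a : ℝ | a ≠ 0}, γ * z.1.1 + δ ≠ 0 := fun z hz => (h _ _ _ hz.1).1
    have : ContDiffOn ℝ ∞ (fun z : (ℝ × ℝ × ℝ) × ℝ => (((α * z.1.1 + β) / (γ * z.1.1 + δ),
        (z.1.2.1 + μ₁ * z.1.1 + μ₀) / (γ * z.1.1 + δ),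
        ((γ * z.1.1 + δ) * z.1.2.2 - γ * z.1.2.1 + μ₁ * δ - μ₀ * γ) / (α * δ - β * γ)),
        z.2 / (α * δ - β * γ))) (Ω ×ˢ {a : ℝ | a ≠ 0}) :=
      ((ContDiffOn.div (by fun_prop) (by fun_prop) hne).prodMk
        ((ContDiffOn.div (by fun_prop) (by fun_prop) hne).prodMk
          (ContDiffOn.div_const (by fun_prop) _))).prodMk (ContDiffOn.div_const (by fun_prop) _)
    exact this.congr fun z hz => (h _ _ _ hz.1).2 z.2 hz.2
  refine ⟨hΩ, hc, hcd, ?_, ?_, ?_⟩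
  · rintro ⟨t, x, u⟩ hp a ha
    have hmem : Ω ×ˢ {a : ℝ | a ≠ 0} ∈ 𝓝 ((t, x, u), a) := hΩa.mem_nhds ⟨hp, ha⟩
    refine projective_det_ne_zero (μ₀ := μ₀) (μ₁ := μ₁) hΔ (h t x u hp).1
      ((hcd.contDiffAt hmem).differentiableAt (by simp)) ?_
    filter_upwards [hmem] with z hz
    exact (h _ _ _ hz.1).2 z.2 hz.2
  · rintro ⟨t, x, u⟩ hp a b ha hb
    rw [(h t x u hp).2 a ha, (h t x u hp).2 b hb]
  · intro L
    -- The projection of `Ω` to the time axis is an open interval free of poles.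
    obtain ⟨L', hL'⟩ := exists_image_equation (α := α) (β := β) (γ := γ) (δ := δ) L hΔ
      (J := Prod.fst '' Ω) (isOpenMap_fst Ω hΩ) (hc.image _ continuousOn_fst).isPreconnected
      (by rintro _ ⟨⟨t, x, u⟩, hp, rfl⟩; exact (h t x u hp).1)
    have hpt : ∀ p ∈ Ω, p.1 ∈ L.dom →
        (Ψ (p, L.coeff p.1)).1.1 ∈ L'.dom ∧
        L'.coeff (Ψ (p, L.coeff p.1)).1.1 = L.coeff p.1 / (α * δ - β * γ) := by
      rintro ⟨t, x, u⟩ hp hd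
      rw [(h t x u hp).2 _ (L.coeff_ne_zero t hd)]
      exact hL' t ⟨⟨_, hp, rfl⟩, hd⟩
    refine ⟨L', ?_, ?_⟩
    · rintro ⟨t, x, u⟩ hp hd
      refine ⟨(hpt _ hp hd).1, (hpt _ hp hd).2.trans ?_⟩
      rw [(h t x u hp).2 _ (L.coeff_ne_zero t hd)]
    · have hpr : IsProjective {p ∈ Ω | p.1 ∈ L.dom} (fun p => (Ψ (p, L.coeff p.1)).1)
          α β γ δ μ₀ μ₁ := by
        rintro t x u ⟨hp, hd⟩
        refine ⟨(h t x u hp).1, ?_⟩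
        simp only
        rw [(h t x u hp).2 _ (L.coeff_ne_zero t hd)]
      exact hpr.mapsBurgers (hΩ.inter (L.isOpen_dom.preimage continuous_fst)) hΔ
        fun p hp => (hpt p hp.1 hp.2).2

end Converse

/-! ### Normalization and the main theorem -/

theorem burgersNormalizedUsual : BurgersNormalizedUsual := by
  intro L L' Ω Φ h
  obtain ⟨α, β, γ, δ, μ₀, μ₁, hΔ, hpr, hs⟩ := h.isProjective
  refine ⟨fun z => (((α * z.1.1 + β) / (γ * z.1.1 + δ),
    (z.1.2.1 + μ₁ * z.1.1 + μ₀) / (γ * z.1.1 + δ),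
    ((γ * z.1.1 + δ) * z.1.2.2 - γ * z.1.2.1 + μ₁ * δ - μ₀ * γ) / (α * δ - β * γ)),
    z.2 / (α * δ - β * γ)), ?_, ?_⟩
  · exact isUsualEquivalence_of_parameters (μ₀ := μ₀) (μ₁ := μ₁) h.isPointTransformation.isOpen
      h.isPointTransformation.isConnected hΔ fun t x u hp => ⟨(hpr t x u hp).1, fun _ _ => rfl⟩
  · intro p hp
    exact Prod.ext (hpr _ _ _ hp).2.symm (h.coeff_eq hΔ hs hp).symm

theorem mainTheorem8 :
    BurgersNormalizedUsual ∧
    ∀ (Ω : Set (ℝ × ℝ × ℝ)) (Ψ : (ℝ × ℝ × ℝ) × ℝ → (ℝ × ℝ × ℝ) × ℝ),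
      IsUsualEquivalence Ω Ψ ↔
        IsOpen Ω ∧ IsConnected Ω ∧
        ∃ α β γ δ μ₀ μ₁ : ℝ, α * δ - β * γ ≠ 0 ∧
          ∀ t x u : ℝ, (t, x, u) ∈ Ω →
            γ * t + δ ≠ 0 ∧
            ∀ g : ℝ, g ≠ 0 →
              Ψ ((t, x, u), g) =
                (((α * t + β) / (γ * t + δ),
                  (x + μ₁ * t + μ₀) / (γ * t + δ),
                  ((γ * t + δ) * u - γ * x + μ₁ * δ - μ₀ * γ) / (α * δ - β * γ)),
                 g / (α * δ - β * γ)) := by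
  refine ⟨burgersNormalizedUsual, fun Ω Ψ => ⟨fun h => ⟨h.isOpen, h.isConnected,
    h.exists_parameters⟩, ?_⟩⟩
  rintro ⟨hΩ, hc, α, β, γ, δ, μ₀, μ₁, hΔ, h⟩
  exact isUsualEquivalence_of_parameters hΩ hc hΔ h
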